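/- Let $K$ be $\mathbb{R}$ or $\mathbb{C}$, let $\mathfrak{g}$ be a finite-dimensional simple Lie algebra over $K$ with a splitting Cartan subalgebra $\mathfrak{h}$ of dimension $s$, let $\Delta$ be a base of the root system $\Phi$, and $\Phi_+$ the positive roots. Fix a faithful finite-dimensional representation of $\mathfrak{g}$ (for instance one of minimal dimension) and write $\mathrm{tr}(xy)$ for its trace form. Let $h_1,\dots,h_s$ be a basis of $\mathfrak{h}$ that is orthonormal for the trace form, and for $\alpha\in\Phi_+$ let $e_\alpha\in\mathfrak{g}_\alpha$, $f_\alpha\in\mathfrak{g}_{-\alpha}$ with $\mathrm{tr}(e_\alpha f_\alpha)=1$. Let $N\ge 0$, let $\mathfrak{g}_N=\mathfrak{g}\otimes_K K[u]/\langle u^{N+1}\rangle$ be the Takiff algebra, and write $x(k)=x\otimes u^k$. Let $(\cdot|\cdot)_N$ be the nondegenerate form with $(x(i)|y(j))_N=\delta_{i+j,N}\,\mathrm{tr}(xy)$, and $\nu:\mathfrak{g}_N\to\mathfrak{g}_N^*$, $\nu(x)=(x|\cdot)_N$. Let $R:\mathfrak{g}_N\to\mathfrak{g}_N$ be obtained by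 contracting, by means of this form, the second tensor factor of $\frac12\sum_{\alpha\in\Phi_+}\sum_{i=0}^N\big(e_\alpha(i)\otimes f_\alpha(N-i)-f_\alpha(N-i)\otimes e_\alpha(i)\big)$. (Thus $R=0$ on $h_i(k)$, $R=\frac12$ on $e_\alpha(k)$, $R=-\frac12$ on $f_\alpha(k)$.) Put $[X,Y]_R=[RX,Y]+[X,RY]$ and $\mathfrak{g}_N^R=(\mathfrak{g}_N,[\cdot,\cdot]_R)$. Let $G_N^R$ be any connected Lie group over $K$ with Lie algebra $\mathfrak{g}_N^R$. It acts on $\mathfrak{g}_N^*$ by the coadjoint representation $\mathrm{Ad}_R^*(g)\mu=\mu\circ\mathrm{Ad}(g^{-1})$, hence on $\mathfrak{g}_N$ by $\mathrm{Ad}_R^*(g)x=\nu^{-1}(\mathrm{Ad}_R^*(g)\nu(x))$. Let $$V=\mathrm{Span}\{h_i(k),\ e_\alpha(k)+f_\alpha(k)\ :\ 1\le i\le s,\ \alpha\in\Delta,\ 0\le k\le N\},\qquad x'=\sum_{\alpha\in\Delta}(e_\alpha(0)+f_\alpha(0)),$$ and $\mathcal{O}=\mathrm{Ad}_R^*(G_N^R)x'\subseteq\mathfrak{g}_N$.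 Then: (i) $V$ is a $G_N^R$-submodule of the coadjoint representation $(\mathfrak{g}_N,\mathrm{Ad}_R^*)$. (ii) $\dim V=2s(N+1)$, and $\mathcal{O}$ is contained in $V$ and is an open subset of $V$. In particular, the Poisson algebra of polynomial functions on $\mathcal{O}$ is identified with $(S(V),\{\cdot,\cdot\}_R)$, in the following sense. Let $\{\cdot,\cdot\}_R$ be the bracket on $S(\mathfrak{g}_N)$ that satisfies the Leibniz rule in each variable and $\{x,y\}_R=[x,y]_R$ for $x,y\in\mathfrak{g}_N$, and view elements of $S(\mathfrak{g}_N)$, and of $S(V)\subseteq S(\mathfrak{g}_N)$, as functions on $\mathcal{O}$ by letting $y\in\mathfrak{g}_N$ stand for $x\mapsto(y|x)_N$. Let $\mathrm{pr}_V:\mathfrak{g}_N\to V$ be the linear map $$\mathrm{pr}_V(z)=\sum_{k=0}^N\Big(\sum_{i=1}^s (h_i(N-k)|z)_N\,h_i(k)+\tfrac12\sum_{\alpha\in\Delta}(e_\alpha(N-k)+f_\alpha(N-k)|z)_N\,(e_\alpha(k)+f_\alpha(k))\Big).$$ It satisfies $(\mathrm{pr}_V z|v)_N=(z|v)_N$ for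 all $z\in\mathfrak{g}_N$, $v\in V$, so $\mathrm{pr}_V z$ and $z$ define the same function on $\mathcal{O}\subseteq V$. Let $\{\cdot,\cdot\}_R$ on $S(V)$ be the bracket that satisfies the Leibniz rule in each variable and $\{v,w\}_R=\mathrm{pr}_V[v,w]_R$ for $v,w\in V$. Then there is a Poisson bracket on the algebra of polynomial functions on $\mathcal{O}$ (the algebra generated by the restrictions to $\mathcal{O}$ of the linear functions on $\mathfrak{g}_N$) for which the restriction map from $(S(\mathfrak{g}_N),\{\cdot,\cdot\}_R)$ is compatible with brackets, and for this bracket the restriction map from $(S(V),\{\cdot,\cdot\}_R)$ to the polynomial functions on $\mathcal{O}$ is an isomorphism of Poisson algebras. -/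

import Mathlib

open scoped TensorProduct Manifold Topology

namespace TakiffToda

noncomputable section

/-! ### Symmetric algebras: derivations and Lie-Poisson brackets -/

section Poisson

variable {K : Type*} [Field K] {M : Type*} [AddCommGroup M] [Module K M]

/-- The algebra homomorphism `m ↦ m + ε d(m)` from the symmetric algebra to its dual numbers. -/
def symLift (d : M →ₗ[K] SymmetricAlgebra K M) :
    SymmetricAlgebra K M →ₐ[K]
      TrivSqZeroExt (SymmetricAlgebra K M) (SymmetricAlgebra K M) :=
  SymmetricAlgebra.lift
    ((TrivSqZeroExt.inlAlgHom K (SymmetricAlgebra K M) (SymmetricAlgebra K M)).toLinearMap ∘ₗ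
        SymmetricAlgebra.ι K M +
      (TrivSqZeroExt.inrHom (SymmetricAlgebra K M) (SymmetricAlgebra K M)).restrictScalars K ∘ₗ d)

theorem symLift_fst (d : M →ₗ[K] SymmetricAlgebra K M) (F : SymmetricAlgebra K M) :
    (symLift d F).fst = F := by
  have : (TrivSqZeroExt.fstHom K (SymmetricAlgebra K M) (SymmetricAlgebra K M)).comp (symLift d) =
      AlgHom.id K _ := by
    apply SymmetricAlgebra.algHom_ext
    ext m
    simp [symLift]
  exact DFunLike.congr_fun this F

/-- The derivation of the symmetric algebra that extends a linear map `d` on the generators. -/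
def symDerivation (d : M →ₗ[K] SymmetricAlgebra K M) :
    Derivation K (SymmetricAlgebra K M) (SymmetricAlgebra K M) :=
  Derivation.mk' ((TrivSqZeroExt.sndHom (SymmetricAlgebra K M)
      (SymmetricAlgebra K M)).restrictScalars K ∘ₗ (symLift d).toLinearMap) (by
    intro F G
    simp [symLift_fst, mul_comm])

@[simp]
theorem symDerivation_ι (d : M →ₗ[K] SymmetricAlgebra K M) (m : M) :
    symDerivation d (SymmetricAlgebra.ι K M m) = d m := by
  simp [symDerivation, symLift]

theorem symDerivation_ext {D₁ D₂ : Derivation K (SymmetricAlgebra K M) (SymmetricAlgebra K M)}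
    (h : ∀ m, D₁ (SymmetricAlgebra.ι K M m) = D₂ (SymmetricAlgebra.ι K M m)) : D₁ = D₂ := by
  ext F
  induction F using SymmetricAlgebra.induction with
  | algebraMap r => simp
  | ι x => exact h x
  | mul a b ha hb => simp [ha, hb]
  | add a b ha hb => simp [ha, hb]

/-- `symDerivation` as a linear map. -/
def symDerivationₗ : (M →ₗ[K] SymmetricAlgebra K M) →ₗ[K]
    Derivation K (SymmetricAlgebra K M) (SymmetricAlgebra K M) where
  toFun := symDerivation
  map_add' d₁ d₂ := symDerivation_ext fun m => by simp
  map_smul' c d := symDerivation_ext fun m => by simp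

/-- The bracket `{F, G}` on the symmetric algebra of `M` that is determined by the Leibniz rule in
both variables and by `{x, y} = br x y` for `x, y ∈ M`. -/
def symBracket (br : M →ₗ[K] M →ₗ[K] M) :
    SymmetricAlgebra K M →ₗ[K] SymmetricAlgebra K M →ₗ[K] SymmetricAlgebra K M :=
  let ham : M →ₗ[K] SymmetricAlgebra K M →ₗ[K] SymmetricAlgebra K M :=
    LinearMap.mk₂ K (fun x G => symDerivationₗ (SymmetricAlgebra.ι K M ∘ₗ br x) G)
      (fun x y G => by simp [LinearMap.comp_add]) (fun c x G => by simp [LinearMap.comp_smul])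
      (fun x F G => by simp) (fun c x F => by simp)
  LinearMap.mk₂ K (fun F G => symDerivationₗ (ham.flip G) F)
    (fun F F' G => by simp) (fun c F G => by simp)
    (fun F G G' => by simp) (fun c F G => by simp)

theorem symBracket_ι_ι (br : M →ₗ[K] M →ₗ[K] M) (x y : M) :
    symBracket br (SymmetricAlgebra.ι K M x) (SymmetricAlgebra.ι K M y) =
      SymmetricAlgebra.ι K M (br x y) := by
  simp [symBracket, symDerivationₗ]

theorem symBracket_mul_left (br : M →ₗ[K] M →ₗ[K] M) (F F' G : SymmetricAlgebra K M) :
    symBracket br (F * F') G = F * symBracket br F' G + F' * symBracket br F G := by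
  simp [symBracket]

theorem symBracket_ι_mul (br : M →ₗ[K] M →ₗ[K] M) (x : M) (G G' : SymmetricAlgebra K M) :
    symBracket br (SymmetricAlgebra.ι K M x) (G * G') =
      G * symBracket br (SymmetricAlgebra.ι K M x) G' +
        G' * symBracket br (SymmetricAlgebra.ι K M x) G := by
  simp [symBracket, symDerivationₗ]

/-- A Poisson bracket on a commutative algebra. -/
structure IsPoissonBracket {A : Type*} [CommRing A] [Algebra K A] (P : A →ₗ[K] A →ₗ[K] A) :
    Prop where
  self_eq_zero : ∀ a, P a a = 0
  leibniz : ∀ a b c, P a (b * c) = P a b * c + b * P a c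
  jacobi : ∀ a b c, P a (P b c) + P b (P c a) + P c (P a b) = 0

end Poisson

/-! ### Takiff algebras -/

section Takiff

/-- The truncated polynomial algebra `K[u]/⟨u^(N+1)⟩`. -/
abbrev Trunc (K : Type*) [Field K] (N : ℕ) : Type _ :=
  AdjoinRoot ((Polynomial.X : Polynomial K) ^ (N + 1))

/-- The Takiff algebra `𝔤_N = K[u]/⟨u^(N+1)⟩ ⊗ 𝔤`; its Lie bracket is Mathlib's bracket on the
extension of scalars, `[a ⊗ x, b ⊗ y] = ab ⊗ [x, y]`. -/
abbrev Takiff (K L : Type*) [Field K] [LieRing L] [LieAlgebra K L] (N : ℕ) : Type _ :=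
  Trunc K N ⊗[K] L

variable {K L : Type*} [Field K] [LieRing L] [LieAlgebra K L] (N : ℕ)

/-- The element `x(k) = u^k ⊗ x` of the Takiff algebra. -/
def el (k : ℕ) (x : L) : Takiff K L N :=
  (AdjoinRoot.root ((Polynomial.X : Polynomial K) ^ (N + 1)) ^ k) ⊗ₜ[K] x

/-- The coefficient of `u^N`. -/
def topCoeff (K : Type*) [Field K] (N : ℕ) : Trunc K N →ₗ[K] K :=
  Polynomial.lcoeff K N ∘ₗ AdjoinRoot.modByMonicHom (Polynomial.monic_X_pow (N + 1))

variable (K L) in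
/-- The form `(a ⊗ x | b ⊗ y)_N = (coefficient of u^N in ab) · tr(xy)`, where the trace is taken in
the representation `W` of `𝔤`. Thus `(x(i) | y(j))_N = δ_{i+j,N} tr(xy)`. -/
def form (W : Type*) [AddCommGroup W] [Module K W] [LieRingModule L W] [LieModule K L W] :
    LinearMap.BilinForm K (Takiff K L N) :=
  LinearMap.BilinForm.tmul ((LinearMap.mul K (Trunc K N)).compr₂ (topCoeff K N))
    (LieModule.traceForm K L W)

theorem topCoeff_root_pow (k : ℕ) (hk : k ≤ N) :
    topCoeff K N (AdjoinRoot.root ((Polynomial.X : Polynomial K) ^ (N + 1)) ^ k) =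
      if k = N then 1 else 0 := by
  rw [topCoeff, LinearMap.comp_apply, ← AdjoinRoot.mk_X, ← map_pow, AdjoinRoot.modByMonicHom_mk,
    (Polynomial.modByMonic_eq_self_iff (Polynomial.monic_X_pow (N + 1))).2]
  · simp [Polynomial.coeff_X_pow, eq_comm]
  · rw [Polynomial.degree_X_pow, Polynomial.degree_X_pow]
    exact_mod_cast Nat.lt_succ_of_le hk

theorem root_pow_eq_zero (k : ℕ) (hk : N < k) :
    AdjoinRoot.root ((Polynomial.X : Polynomial K) ^ (N + 1)) ^ k = 0 := by
  rw [← AdjoinRoot.mk_X, ← map_pow, AdjoinRoot.mk_eq_zero]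
  exact pow_dvd_pow _ hk

theorem form_el_el (W : Type*) [AddCommGroup W] [Module K W] [LieRingModule L W]
    [LieModule K L W] (i j : ℕ) (x y : L) :
    form K L N W (el N i x) (el N j y) =
      if i + j = N then LieModule.traceForm K L W x y else 0 := by
  have : topCoeff K N (AdjoinRoot.root ((Polynomial.X : Polynomial K) ^ (N + 1)) ^ (i + j)) =
      if i + j = N then 1 else 0 := by
    rcases le_or_gt (i + j) N with h | h
    · exact topCoeff_root_pow N _ h
    · rw [root_pow_eq_zero N _ h, map_zero, if_neg h.ne']
  simp [form, el, ← pow_add, this]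

theorem exists_eq_sum_el (z : Takiff K L N) :
    ∃ c : Fin (N + 1) → L, z = ∑ i : Fin (N + 1), el N (i : ℕ) (c i) := by
  induction z using TensorProduct.induction_on with
  | zero => exact ⟨0, by simp [el]⟩
  | add a b ha hb =>
    obtain ⟨c, rfl⟩ := ha
    obtain ⟨d, rfl⟩ := hb
    exact ⟨c + d, by simp [el, TensorProduct.tmul_add, Finset.sum_add_distrib]⟩
  | tmul a x =>
    let p := AdjoinRoot.modByMonicHom (Polynomial.monic_X_pow (R := K) (N + 1)) a
    have hp : p.natDegree < N + 1 := by
      obtain ⟨q, rfl⟩ := AdjoinRoot.mk_surjective a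
      simp only [p, AdjoinRoot.modByMonicHom_mk]
      have := Polynomial.natDegree_modByMonic_lt q (Polynomial.monic_X_pow (R := K) (N + 1))
        (fun h => by simpa using congrArg Polynomial.natDegree h)
      simpa using this
    refine ⟨fun i => p.coeff i • x, ?_⟩
    have ha : a = ∑ i : Fin (N + 1), p.coeff i •
        AdjoinRoot.root ((Polynomial.X : Polynomial K) ^ (N + 1)) ^ (i : ℕ) := by
      rw [Fin.sum_univ_eq_sum_range (fun i => p.coeff i •
        AdjoinRoot.root ((Polynomial.X : Polynomial K) ^ (N + 1)) ^ i)]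
      conv_lhs => rw [← AdjoinRoot.mk_leftInverse (Polynomial.monic_X_pow (R := K) (N + 1)) a]
      change AdjoinRoot.mk _ p = _
      conv_lhs => rw [p.as_sum_range' (N + 1) hp]
      simp [← Polynomial.C_mul_X_pow_eq_monomial, Algebra.smul_def]
    conv_lhs => rw [ha]
    simp [el, TensorProduct.sum_tmul, TensorProduct.smul_tmul]

end Takiff

/-! ### The data of the Toda system -/

/-- The choices made for a finite-dimensional split simple Lie algebra `𝔤 = L` with splitting Cartan
subalgebra `𝔥 = H` and representation `W`: a base of simple roots, a basis `h_1, …, h_s` of `𝔥` that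
is orthonormal for the trace form of `W`, and for each positive root `α` root vectors
`e_α ∈ 𝔤_α`, `f_α ∈ 𝔤_{-α}` with `tr(e_α f_α) = 1`.
The values of `e` and `f` at roots that are not positive play no role. -/
structure TodaData (K : Type*) [RCLike K] (L : Type*) [LieRing L] [LieAlgebra K L]
    [FiniteDimensional K L] [LieAlgebra.IsSimple K L] (H : LieSubalgebra K L)
    [H.IsCartanSubalgebra] [LieModule.IsTriangularizable K H L]
    (W : Type*) [AddCommGroup W] [Module K W] [LieRingModule L W] [LieModule K L W] (s : ℕ) where
  base : (LieAlgebra.IsKilling.rootSystem H).Base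
  h : Module.Basis (Fin s) K H
  h_orthonormal : ∀ i j, LieModule.traceForm K L W (h i) (h j) = if i = j then 1 else 0
  e : H.root → L
  f : H.root → L
  e_mem : ∀ α, base.IsPos α → e α ∈ LieAlgebra.rootSpace H (α : LieModule.Weight K H L)
  f_mem : ∀ α, base.IsPos α → f α ∈ LieAlgebra.rootSpace H (-(α : LieModule.Weight K H L) : H → K)
  trace_e_f : ∀ α, base.IsPos α → LieModule.traceForm K L W (e α) (f α) = 1

namespace TodaData

variable {K : Type*} [RCLike K] {L : Type*} [LieRing L] [LieAlgebra K L]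
  [FiniteDimensional K L] [LieAlgebra.IsSimple K L] {H : LieSubalgebra K L}
  [H.IsCartanSubalgebra] [LieModule.IsTriangularizable K H L]
  {W : Type*} [AddCommGroup W] [Module K W] [LieRingModule L W] [LieModule K L W] {s : ℕ}

theorem traceForm_radical (D : TodaData K L H W s) (x : L)
    (hx : ∀ y, LieModule.traceForm K L W x y = 0) : x = 0 := by
  have hinv : (LieModule.traceForm K L W).lieInvariant L := LieModule.traceForm_lieInvariant K L W
  let I : LieIdeal K L := LieAlgebra.InvariantForm.orthogonal _ hinv ⊤
  have hxI : x ∈ I := by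
    rw [LieAlgebra.InvariantForm.mem_orthogonal]
    intro y _
    rw [LieModule.traceForm_comm]
    exact hx y
  rcases LieAlgebra.IsSimple.eq_bot_or_eq_top (R := K) I with h | h
  · rw [h] at hxI
    simpa using hxI
  · exfalso
    have hL : Nontrivial L := by
      by_contra hc
      rw [not_nontrivial_iff_subsingleton] at hc
      exact LieAlgebra.IsSimple.non_abelian K (L := L) ⟨fun _ _ => Subsingleton.elim _ _⟩
    have hs : Nonempty (Fin s) := D.h.index_nonempty
    obtain ⟨i⟩ := hs
    have hi : (D.h i : L) ∈ I := h ▸ LieSubmodule.mem_top _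
    rw [LieAlgebra.InvariantForm.mem_orthogonal] at hi
    have := hi (D.h i : L) (LieSubmodule.mem_top _)
    rw [D.h_orthonormal] at this
    simp at this

theorem form_injective (D : TodaData K L H W s) (N : ℕ) :
    Function.Injective (form K L N W) := by
  rw [← LinearMap.ker_eq_bot, LinearMap.ker_eq_bot']
  intro z hz
  obtain ⟨c, rfl⟩ := exists_eq_sum_el N z
  have hc : ∀ j, c j = 0 := by
    intro j
    apply D.traceForm_radical
    intro y
    have := LinearMap.congr_fun hz (el N (N - j) y)
    rw [map_sum, LinearMap.sum_apply] at this
    rw [Finset.sum_eq_single j] at this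
    · rw [form_el_el, if_pos (by omega)] at this
      exact this
    · intro i _ hij
      rw [form_el_el, if_neg]
      intro h
      apply hij
      ext
      omega
    · simp
  simp [hc, el]

/-- The isomorphism `ν : 𝔤_N → 𝔤_N^*`, `ν(x) = (x | -)_N`. -/
def ν (D : TodaData K L H W s) (N : ℕ) : Takiff K L N ≃ₗ[K] Module.Dual K (Takiff K L N) :=
  haveI : Module.Finite K (Trunc K N) :=
    (AdjoinRoot.powerBasis' (Polynomial.monic_X_pow (R := K) (N + 1))).finite
  LinearEquiv.ofInjectiveOfFinrankEq (form K L N W) (D.form_injective N)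
    (Subspace.dual_finrank_eq (K := K) (V := Takiff K L N)).symm

theorem ν_apply (D : TodaData K L H W s) (N : ℕ) (x y : Takiff K L N) :
    D.ν N x y = form K L N W x y := rfl

open scoped Classical in
/-- The set of positive roots. -/
def posRoots (D : TodaData K L H W s) : Finset H.root :=
  Finset.univ.filter fun α => D.base.IsPos α

/-- The operator `R(X) = Tr_{N,2}(r₁₂ X₂)` obtained by contracting the second tensor factor of
`r₁₂ = ½ ∑_{α > 0} ∑_{i ≤ N} (e_α(i) ⊗ f_α(N-i) - f_α(N-i) ⊗ e_α(i))` with `X` by means of the form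
`(-|-)_N`. -/
def R (D : TodaData K L H W s) (N : ℕ) : Takiff K L N →ₗ[K] Takiff K L N :=
  (1 / 2 : K) • ∑ α ∈ D.posRoots, ∑ i ∈ Finset.range (N + 1),
    ((form K L N W (el N (N - i) (D.f α))).smulRight (el N i (D.e α)) -
      (form K L N W (el N i (D.e α))).smulRight (el N (N - i) (D.f α)))

/-- The `R`-deformed bracket `[X, Y]_R = [RX, Y] + [X, RY]`. -/
def bracketR (D : TodaData K L H W s) (N : ℕ) :
    Takiff K L N →ₗ[K] Takiff K L N →ₗ[K] Takiff K L N :=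
  LinearMap.mk₂ K (fun X Y => ⁅D.R N X, Y⁆ + ⁅X, D.R N Y⁆)
    (fun X X' Y => by simp only [map_add, add_lie]; abel)
    (fun c X Y => by simp only [map_smul, smul_lie, smul_add])
    (fun X Y Y' => by simp only [map_add, lie_add]; abel)
    (fun c X Y => by simp only [map_smul, lie_smul, smul_add])

/-- `V = Span {h_i(k), e_α(k) + f_α(k) : 1 ≤ i ≤ s, α simple, 0 ≤ k ≤ N}`. -/
def V (D : TodaData K L H W s) (N : ℕ) : Submodule K (Takiff K L N) :=
  Submodule.span K
    ({v | ∃ i : Fin s, ∃ k ≤ N, v = el N k (D.h i : L)} ∪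
      {v | ∃ α ∈ D.base.support, ∃ k ≤ N, v = el N k (D.e α) + el N k (D.f α)})

/-- `x' = ∑_{α simple} (e_α(0) + f_α(0))`. -/
def x' (D : TodaData K L H W s) (N : ℕ) : Takiff K L N :=
  ∑ α ∈ D.base.support, (el N 0 (D.e α) + el N 0 (D.f α))

end TodaData

/-! ### Lie groups and the coadjoint representation -/

section LieGroup

variable {K : Type*} [RCLike K] {E : Type*} [NormedAddCommGroup E] [NormedSpace K E]
  {G : Type*} [TopologicalSpace G] [ChartedSpace E G] [Group G]

variable (K E) in
/-- The adjoint representation of a Lie group: `Ad g` is the derivative at `1` of `x ↦ g x g⁻¹`.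
(The tangent spaces at `1` and at `g * 1 * g⁻¹ = 1` are the same.) -/
def Ad (g : G) : GroupLieAlgebra 𝓘(K, E) G →ₗ[K] GroupLieAlgebra 𝓘(K, E) G :=
  (mfderiv 𝓘(K, E) 𝓘(K, E) (fun x : G => g * x * g⁻¹) 1 : E →L[K] E).toLinearMap

variable {L : Type*} [LieRing L] [LieAlgebra K L]
  [FiniteDimensional K L] [LieAlgebra.IsSimple K L] {H : LieSubalgebra K L}
  [H.IsCartanSubalgebra] [LieModule.IsTriangularizable K H L]
  {W : Type*} [AddCommGroup W] [Module K W] [LieRingModule L W] [LieModule K L W] {s : ℕ}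

namespace TodaData

/-- An identification of the Lie algebra of the Lie group `G` with `𝔤_N^R = (𝔤_N, [-,-]_R)`. -/
structure LieAlgIdent (D : TodaData K L H W s) (N : ℕ) (E G : Type*) [NormedAddCommGroup E]
    [NormedSpace K E] [TopologicalSpace G] [ChartedSpace E G] [Group G] where
  toEquiv : GroupLieAlgebra 𝓘(K, E) G ≃ₗ[K] Takiff K L N
  map_bracket : ∀ X Y : GroupLieAlgebra 𝓘(K, E) G,
    toEquiv ⁅X, Y⁆ = D.bracketR N (toEquiv X) (toEquiv Y)

variable {D : TodaData K L H W s} {N : ℕ}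

/-- The coadjoint action on `𝔤_N^*`: `(Ad_R^* g) μ = μ ∘ Ad(g⁻¹)`. -/
def coadjointDual (φ : D.LieAlgIdent N E G) (g : G) :
    Module.Dual K (Takiff K L N) →ₗ[K] Module.Dual K (Takiff K L N) :=
  (φ.toEquiv.toLinearMap ∘ₗ Ad K E g⁻¹ ∘ₗ φ.toEquiv.symm.toLinearMap).dualMap

/-- The coadjoint action on `𝔤_N`: `(Ad_R^* g) x = ν⁻¹ ((Ad_R^* g) ν(x))`. -/
def coadjoint (φ : D.LieAlgIdent N E G) (g : G) : Takiff K L N →ₗ[K] Takiff K L N :=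
  (D.ν N).symm.toLinearMap ∘ₗ coadjointDual φ g ∘ₗ (D.ν N).toLinearMap

/-- The coadjoint orbit `𝒪 = Ad_R^*(G) x'`. -/
def orbit (φ : D.LieAlgIdent N E G) : Set (Takiff K L N) :=
  Set.range fun g : G => coadjoint φ g (D.x' N)

end TodaData

end LieGroup

/-! ### Polynomial functions and Poisson brackets -/

section Functions

/-- The algebra of polynomial functions on a subset `O` of a vector space `T`: the functions on `O`
generated by the restrictions of linear functions. -/
def polyFun (K : Type*) [Field K] {T : Type*} [AddCommGroup T] [Module K T] (O : Set T) :
    Subalgebra K (O → K) :=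
  Algebra.adjoin K (Set.range fun (l : Module.Dual K T) (x : O) => l x)

variable {K : Type*} [RCLike K] {L : Type*} [LieRing L] [LieAlgebra K L]
  [FiniteDimensional K L] [LieAlgebra.IsSimple K L] {H : LieSubalgebra K L}
  [H.IsCartanSubalgebra] [LieModule.IsTriangularizable K H L]
  {W : Type*} [AddCommGroup W] [Module K W] [LieRingModule L W] [LieModule K L W] {s : ℕ}

namespace TodaData

/-- The linear function `x ↦ (y | x)_N` on `O ⊆ 𝔤_N` attached to `y ∈ 𝔤_N`. -/
def linFun (D : TodaData K L H W s) (N : ℕ) (O : Set (Takiff K L N)) :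
    Takiff K L N →ₗ[K] polyFun K O where
  toFun y := ⟨fun x => D.ν N y x, Algebra.subset_adjoin ⟨D.ν N y, rfl⟩⟩
  map_add' y z := by ext; simp
  map_smul' c y := by ext; simp

/-- The elements of `S(𝔤_N)` are the regular functions on `𝔤_N^*`, hence on `𝔤_N` by way of `ν`;
this is their restriction to `O ⊆ 𝔤_N`. -/
def restrict (D : TodaData K L H W s) (N : ℕ) (O : Set (Takiff K L N)) :
    SymmetricAlgebra K (Takiff K L N) →ₐ[K] polyFun K O :=
  SymmetricAlgebra.lift (D.linFun N O)

/-- The elements of `S(V)`, for `V ⊆ 𝔤_N`, as functions on `O`. -/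
def restrictV (D : TodaData K L H W s) (N : ℕ) (O : Set (Takiff K L N)) :
    SymmetricAlgebra K (D.V N) →ₐ[K] polyFun K O :=
  SymmetricAlgebra.lift (D.linFun N O ∘ₗ (D.V N).subtype)

theorem h_mem_V (D : TodaData K L H W s) (N : ℕ) (i : Fin s) (k : ℕ) (hk : k ≤ N) :
    el N k (D.h i : L) ∈ D.V N :=
  Submodule.subset_span (Or.inl ⟨i, k, hk, rfl⟩)

theorem ef_mem_V (D : TodaData K L H W s) (N : ℕ) (α : H.root) (hα : α ∈ D.base.support) (k : ℕ)
    (hk : k ≤ N) : el N k (D.e α) + el N k (D.f α) ∈ D.V N :=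
  Submodule.subset_span (Or.inr ⟨α, hα, k, hk, rfl⟩)

/-- The orthogonal projection of `𝔤_N` onto `V` for the form `(-|-)_N`, computed in the basis
`h_i(k)`, `e_α(k) + f_α(k)` of `V`, whose dual basis is `h_i(N-k)`, `½ (e_α(N-k) + f_α(N-k))`. -/
def projV (D : TodaData K L H W s) (N : ℕ) : Takiff K L N →ₗ[K] D.V N :=
  ∑ k : Fin (N + 1),
    (∑ i : Fin s, (form K L N W (el N (N - (k : ℕ)) (D.h i : L))).smulRight
        (⟨el N k (D.h i : L), D.h_mem_V N i k (Nat.lt_succ_iff.1 k.2)⟩ : D.V N) +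
      (1 / 2 : K) • ∑ α : D.base.support,
        (form K L N W (el N (N - (k : ℕ)) (D.e α) + el N (N - (k : ℕ)) (D.f α))).smulRight
          (⟨el N k (D.e α) + el N k (D.f α),
            D.ef_mem_V N α α.2 k (Nat.lt_succ_iff.1 k.2)⟩ : D.V N))

/-- The bracket on `V` that underlies `{-,-}_R`: the linear function `([v, w]_R | -)_N` on `V` is
represented by the projection of `[v, w]_R` to `V`. -/
def bracketV (D : TodaData K L H W s) (N : ℕ) : D.V N →ₗ[K] D.V N →ₗ[K] D.V N :=
  ((D.bracketR N).compr₂ (D.projV N)).compl₁₂ (D.V N).subtype (D.V N).subtype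

end TodaData

end Functions

end

end TakiffToda

/-! The infinitesimal statement is root combinatorics. Write `r` for the operator on `𝔤` equal to
`½`, `0`, `-½` on the positive root spaces, the Cartan subalgebra and the negative root spaces. It
is skew for the trace form, so the transpose of `[y, ·]_r` is `coad y v = [v, r y] - r [v, y]`,
which is minus the derivative of the coadjoint action. It vanishes whenever `y` and `[v, y]` lie in
the same eigenspace of `r`. Let `v = e_α + f_α` with `α` simple and let `y` be a root vector for a
positive root `β`. Then `α + β` is never a negative root, and `β - α` is one only if it is not a
root at all, so everything cancels except for `β = α`, where a multiple of `[f_α, y] ∈ H` remains;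
negative root vectors behave in the same way. For `y ∈ H` the vector `e_α + f_α` is an eigenvector,
because both `ad y` and `r` change sign from `e_α` to `f_α`. Hence the span of the `h_i` and `e_α +
f_α` is stable (`coad_mem_todaSpan`). Applied to `∑ (e_α + f_α)`, the action reaches every `e_α +
f_α` by fundamental coweights and all of `H` by the `[e_α, f_α]`, which represent the simple roots
(`exists_coad_sum_eq`). All of this is linear over `K[u]/⟨u^(N+1)⟩` and so passes to `𝔤_N`.

To pass to the group, `Ad` is studied in one chart at the identity, as a `C¹` map `A` whose
derivative at `1` is the Lie bracket (`fderiv_chartAd_eq_bracket`). Multiplicativity of `Ad` gives a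
linear differential equation for `A`, and a Gronwall-type estimate shows that `Ad g` preserves every
ideal for `g` near `1`; connectedness gives all `g` (`Ad_mem_of_forall_bracket_mem`). With the ideal
`V^⊥` this yields the invariance of `V` (`coadjoint_mem_V`). The orbit map has surjective derivative
onto `V` at `1`, so the orbit contains a neighbourhood of `x'` in `V`, and by homogeneity it is open
(`isOpen_orbit`).

Since `V^⊥` is an ideal, the projection to `V` is a Lie algebra homomorphism from `𝔤_N^R`, so
`{·,·}_R` on `S(V)` is Poisson. A polynomial that vanishes on a nonempty open subset of `V` is zero,
so `S(V)` is the algebra of polynomial functions on the orbit, and the required bracket is the one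
transported from `S(V)`. -/

open scoped ContDiff

namespace TakiffToda

noncomputable section

/-! ### Multiplication, conjugation and `Ad` in a chart at the identity -/

section LieGroupChart

variable (K : Type*) [RCLike K] (E : Type*) [NormedAddCommGroup E] [NormedSpace K E]
  (G : Type*) [TopologicalSpace G] [ChartedSpace E G] [Group G]

/-- The image of the identity under the preferred chart at the identity. -/
def chartOne : E := extChartAt 𝓘(K, E) (1 : G) 1

/-- The multiplication of a Lie group in the preferred chart at the identity. -/
def chartMul (p : E × E) : E :=
  extChartAt 𝓘(K, E) (1 : G)
    ((extChartAt 𝓘(K, E) (1 : G)).symm p.1 * (extChartAt 𝓘(K, E) (1 : G)).symm p.2)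

theorem chart_symm_chartOne : (extChartAt 𝓘(K, E) (1 : G)).symm (chartOne K E G) = 1 := by
  simp [chartOne]

variable {K E G}

theorem chartMul_chartOne_left {y : E} (hy : y ∈ (extChartAt 𝓘(K, E) (1 : G)).target) :
    chartMul K E G (chartOne K E G, y) = y := by
  simp only [chartMul, chart_symm_chartOne, one_mul]
  exact (extChartAt 𝓘(K, E) (1 : G)).right_inv hy

theorem chartMul_chartOne_right {y : E} (hy : y ∈ (extChartAt 𝓘(K, E) (1 : G)).target) :
    chartMul K E G (y, chartOne K E G) = y := by
  simp only [chartMul, chart_symm_chartOne, mul_one]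
  exact (extChartAt 𝓘(K, E) (1 : G)).right_inv hy

theorem chart_target_mem_nhds :
    (extChartAt 𝓘(K, E) (1 : G)).target ∈ 𝓝 (chartOne K E G) :=
  extChartAt_target_mem_nhds 1

theorem contMDiffAt_chart_symm {n : ℕ∞ω} [IsManifold 𝓘(K, E) n G] {y : E}
    (hy : y ∈ (extChartAt 𝓘(K, E) (1 : G)).target) :
    ContMDiffAt 𝓘(K, E) 𝓘(K, E) n (extChartAt 𝓘(K, E) (1 : G)).symm y :=
  (contMDiffOn_extChartAt_symm (1 : G)).contMDiffAt (extChartAt_target_mem_nhds' hy)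

theorem contMDiffAt_chart {n : ℕ∞ω} [IsManifold 𝓘(K, E) n G] {g : G}
    (hg : g ∈ (extChartAt 𝓘(K, E) (1 : G)).source) :
    ContMDiffAt 𝓘(K, E) 𝓘(K, E) n (extChartAt 𝓘(K, E) (1 : G)) g :=
  contMDiffAt_extChartAt' (by simpa using hg)

theorem contDiffAt_chartMul {n : ℕ∞ω} [LieGroup 𝓘(K, E) n G] {p : E × E}
    (h1 : p.1 ∈ (extChartAt 𝓘(K, E) (1 : G)).target)
    (h2 : p.2 ∈ (extChartAt 𝓘(K, E) (1 : G)).target)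
    (h12 : (extChartAt 𝓘(K, E) (1 : G)).symm p.1 * (extChartAt 𝓘(K, E) (1 : G)).symm p.2 ∈
      (extChartAt 𝓘(K, E) (1 : G)).source) :
    ContDiffAt K n (chartMul K E G) p := by
  rw [← contMDiffAt_iff_contDiffAt]
  have a1 : ContMDiffAt 𝓘(K, E × E) 𝓘(K, E) n
      (fun p : E × E => (extChartAt 𝓘(K, E) (1 : G)).symm p.1) p :=
    ContMDiffAt.comp p (contMDiffAt_chart_symm h1) contDiff_fst.contMDiff.contMDiffAt
  have a2 : ContMDiffAt 𝓘(K, E × E) 𝓘(K, E) n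
      (fun p : E × E => (extChartAt 𝓘(K, E) (1 : G)).symm p.2) p :=
    ContMDiffAt.comp p (contMDiffAt_chart_symm h2) contDiff_snd.contMDiff.contMDiffAt
  exact ContMDiffAt.comp p (contMDiffAt_chart h12) (a1.mul a2)

theorem contDiffAt_chartMul_chartOne {n : ℕ∞ω} [LieGroup 𝓘(K, E) n G] :
    ContDiffAt K n (chartMul K E G) (chartOne K E G, chartOne K E G) := by
  have h := mem_of_mem_nhds (chart_target_mem_nhds (K := K) (E := E) (G := G))
  apply contDiffAt_chartMul h h
  rw [chart_symm_chartOne, mul_one]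
  exact mem_extChartAt_source 1

theorem mem_nhds_chart_symm_image {s : Set E} (hs : s ∈ 𝓝 (chartOne K E G)) :
    (extChartAt 𝓘(K, E) (1 : G)).symm '' s ∈ 𝓝 (1 : G) := by
  have hc : ContinuousAt (extChartAt 𝓘(K, E) (1 : G)) 1 := continuousAt_extChartAt 1
  filter_upwards [hc hs, extChartAt_source_mem_nhds (I := 𝓘(K, E)) (1 : G)] with g hg hg'
  exact ⟨_, hg, (extChartAt 𝓘(K, E) (1 : G)).left_inv hg'⟩

theorem continuousAt_chart_symm_chartOne :
    Filter.Tendsto (extChartAt 𝓘(K, E) (1 : G)).symm (𝓝 (chartOne K E G)) (𝓝 1) := by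
  have := continuousAt_extChartAt_symm (I := 𝓘(K, E)) (1 : G)
  rw [ContinuousAt] at this
  simpa using! this

/-- `x ↦ g x g⁻¹` in the preferred chart at the identity. -/
def chartConj (g : G) (z : E) : E :=
  extChartAt 𝓘(K, E) (1 : G) (g * (extChartAt 𝓘(K, E) (1 : G)).symm z * g⁻¹)

theorem contMDiff_conj {n : ℕ∞ω} [LieGroup 𝓘(K, E) n G] (g : G) :
    ContMDiff 𝓘(K, E) 𝓘(K, E) n (fun x : G => g * x * g⁻¹) :=
  (contMDiff_mul_right (a := g⁻¹)).comp (contMDiff_mul_left (a := g))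

theorem differentiableAt_chartConj [LieGroup 𝓘(K, E) 1 G] (g : G) :
    DifferentiableAt K (chartConj (K := K) (E := E) g) (chartOne K E G) := by
  have h := mem_of_mem_nhds (chart_target_mem_nhds (K := K) (E := E) (G := G))
  have : ContMDiffAt 𝓘(K, E) 𝓘(K, E) 1 (chartConj (K := K) (E := E) g) (chartOne K E G) := by
    refine ContMDiffAt.comp (I' := 𝓘(K, E)) (chartOne K E G) (contMDiffAt_chart ?_)
      (ContMDiffAt.comp (I' := 𝓘(K, E)) (chartOne K E G) (contMDiff_conj g).contMDiffAt
        (contMDiffAt_chart_symm h))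
    rw [chart_symm_chartOne, mul_one, mul_inv_cancel]
    exact mem_extChartAt_source 1
  exact (contMDiffAt_iff_contDiffAt.1 this).differentiableAt one_ne_zero

/-- The manifold derivative is by definition the derivative in the preferred charts at the source
and target points, so with a boundaryless model it is an ordinary `fderiv`. -/
theorem mfderiv_eq_fderiv_chart {M : Type*} [TopologicalSpace M] [ChartedSpace E M] (f : G → M)
    {g : M} (hg : f 1 = g)
    (hf : MDifferentiableAt 𝓘(K, E) 𝓘(K, E) f 1) :
    (mfderiv 𝓘(K, E) 𝓘(K, E) f 1 : E →L[K] E) =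
      fderiv K (extChartAt 𝓘(K, E) g ∘ f ∘ (extChartAt 𝓘(K, E) (1 : G)).symm)
        (chartOne K E G) := by
  have h : (mfderiv 𝓘(K, E) 𝓘(K, E) f 1 : E →L[K] E) =
      fderivWithin K (writtenInExtChartAt 𝓘(K, E) 𝓘(K, E) 1 f) (Set.range 𝓘(K, E))
        (extChartAt 𝓘(K, E) (1 : G) 1) := hf.mfderiv
  rw [h, modelWithCornersSelf_coe, Set.range_id, fderivWithin_univ, writtenInExtChartAt, hg]
  rfl

theorem Ad_eq_fderiv [LieGroup 𝓘(K, E) 1 G] (g : G) :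
    Ad K E g = (fderiv K (chartConj (K := K) (E := E) g) (chartOne K E G)).toLinearMap := by
  have h := mfderiv_eq_fderiv_chart (K := K) (E := E) (fun x : G => g * x * g⁻¹) (g := 1) (by simp)
    ((contMDiff_conj g).contMDiffAt.mdifferentiableAt one_ne_zero)
  exact congrArg ContinuousLinearMap.toLinearMap h

theorem chartConj_chartOne (g : G) :
    chartConj (K := K) (E := E) g (chartOne K E G) = chartOne K E G := by
  rw [chartConj, chart_symm_chartOne, mul_one, mul_inv_cancel, chartOne]

theorem chart_symm_chartConj [LieGroup 𝓘(K, E) 1 G] (g : G) :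
    ∀ᶠ z in 𝓝 (chartOne K E G),
      (extChartAt 𝓘(K, E) (1 : G)).symm (chartConj (K := K) (E := E) g z) =
        g * (extChartAt 𝓘(K, E) (1 : G)).symm z * g⁻¹ := by
  have hc : Filter.Tendsto (fun z => g * (extChartAt 𝓘(K, E) (1 : G)).symm z * g⁻¹)
      (𝓝 (chartOne K E G)) (𝓝 1) := by
    have h1 : Filter.Tendsto (fun x : G => g * x * g⁻¹) (𝓝 1) (𝓝 1) := by
      have := (contMDiff_conj (K := K) (E := E) (n := 1) g).continuous.tendsto 1
      simpa using this
    exact h1.comp (continuousAt_chart_symm_chartOne (K := K) (E := E))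
  filter_upwards [hc (extChartAt_source_mem_nhds (I := 𝓘(K, E)) (1 : G))] with z hz
  exact (extChartAt 𝓘(K, E) (1 : G)).left_inv hz

theorem Ad_mul [LieGroup 𝓘(K, E) 1 G] (g h : G) : Ad K E (g * h) = Ad K E g ∘ₗ Ad K E h := by
  have hh := differentiableAt_chartConj (K := K) (E := E) h
  have hg := differentiableAt_chartConj (K := K) (E := E) g
  have : chartConj (K := K) (E := E) (g * h) =ᶠ[𝓝 (chartOne K E G)]
      chartConj (K := K) (E := E) g ∘ chartConj (K := K) (E := E) h := by
    filter_upwards [chart_symm_chartConj (K := K) (E := E) h] with z hz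
    simp only [Function.comp, chartConj] at hz ⊢
    rw [hz]
    simp [mul_assoc]
  rw [Ad_eq_fderiv, Ad_eq_fderiv, Ad_eq_fderiv, this.fderiv_eq, fderiv_comp _ _ hh,
    chartConj_chartOne]
  · rfl
  · rw [chartConj_chartOne]; exact hg

theorem Ad_one [LieGroup 𝓘(K, E) 1 G] : Ad K E (1 : G) = LinearMap.id := by
  have : chartConj (K := K) (E := E) (1 : G) =ᶠ[𝓝 (chartOne K E G)] id := by
    filter_upwards [chart_target_mem_nhds (K := K) (E := E) (G := G)] with z hz
    simpa [chartConj] using (extChartAt 𝓘(K, E) (1 : G)).right_inv hz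
  rw [Ad_eq_fderiv, this.fderiv_eq, fderiv_id]
  rfl

end LieGroupChart

/-! ### The derivative of `Ad` at the identity is the Lie bracket -/

section AdDerivative

variable (K : Type*) [RCLike K] (E : Type*) [NormedAddCommGroup E] [NormedSpace K E]
  (G : Type*) [TopologicalSpace G] [ChartedSpace E G] [Group G]

/-- The derivative at the identity of the right translation by `y`, in the preferred chart. -/
def chartRight (y : E) : E →L[K] E :=
  (fderiv K (chartMul K E G) (chartOne K E G, y)).comp (ContinuousLinearMap.inl K E E)

/-- The derivative at the identity of the left translation by `y`, in the preferred chart. -/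
def chartLeft (y : E) : E →L[K] E :=
  (fderiv K (chartMul K E G) (y, chartOne K E G)).comp (ContinuousLinearMap.inr K E E)

/-- The adjoint representation in the preferred chart at the identity. -/
def chartAd (y : E) : E →L[K] E :=
  Ring.inverse (chartRight K E G y) * chartLeft K E G y

variable {K E G}

theorem eventually_differentiableAt_chartMul [LieGroup 𝓘(K, E) 2 G] :
    ∀ᶠ p in 𝓝 (chartOne K E G, chartOne K E G), DifferentiableAt K (chartMul K E G) p := by
  have h := (contDiffAt_chartMul_chartOne (K := K) (E := E) (G := G) (n := 2)).eventually (by simp)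
  filter_upwards [h] with p hp
  exact hp.differentiableAt (by simp)

theorem tendsto_prodMk_chartOne_left :
    Filter.Tendsto (fun y : E => (chartOne K E G, y)) (𝓝 (chartOne K E G))
      (𝓝 (chartOne K E G, chartOne K E G)) :=
  (Continuous.prodMk_right (chartOne K E G)).tendsto _

theorem tendsto_prodMk_chartOne_right :
    Filter.Tendsto (fun y : E => (y, chartOne K E G)) (𝓝 (chartOne K E G))
      (𝓝 (chartOne K E G, chartOne K E G)) :=
  (Continuous.prodMk_left (chartOne K E G)).tendsto _

theorem hasFDerivAt_chartMul_left {y : E}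
    (hy : DifferentiableAt K (chartMul K E G) (chartOne K E G, y)) :
    HasFDerivAt (fun z => chartMul K E G (z, y)) (chartRight K E G y) (chartOne K E G) :=
  HasFDerivAt.comp (f := fun z => (z, y)) (chartOne K E G) hy.hasFDerivAt
    (hasFDerivAt_prodMk_left (chartOne K E G) y)

theorem hasFDerivAt_chartMul_right {y : E}
    (hy : DifferentiableAt K (chartMul K E G) (y, chartOne K E G)) :
    HasFDerivAt (fun z => chartMul K E G (y, z)) (chartLeft K E G y) (chartOne K E G) :=
  hy.hasFDerivAt.comp (chartOne K E G) (hasFDerivAt_prodMk_right y (chartOne K E G))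

theorem contDiffAt_fderiv_chartMul [LieGroup 𝓘(K, E) 2 G] :
    ContDiffAt K 1 (fderiv K (chartMul K E G)) (chartOne K E G, chartOne K E G) :=
  contDiffAt_chartMul_chartOne.fderiv_right (m := 1) (n := 2) (by norm_num)

theorem contDiffAt_chartRight [LieGroup 𝓘(K, E) 2 G] :
    ContDiffAt K 1 (chartRight K E G) (chartOne K E G) := by
  have h : ContDiffAt K 1 (fun y => fderiv K (chartMul K E G) (chartOne K E G, y))
      (chartOne K E G) :=
    ContDiffAt.comp (chartOne K E G) contDiffAt_fderiv_chartMul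
      (contDiff_const.prodMk contDiff_id).contDiffAt
  exact h.clm_comp contDiffAt_const

theorem contDiffAt_chartLeft [LieGroup 𝓘(K, E) 2 G] :
    ContDiffAt K 1 (chartLeft K E G) (chartOne K E G) := by
  have h : ContDiffAt K 1 (fun y => fderiv K (chartMul K E G) (y, chartOne K E G))
      (chartOne K E G) :=
    ContDiffAt.comp (chartOne K E G) contDiffAt_fderiv_chartMul
      (contDiff_id.prodMk contDiff_const).contDiffAt
  exact h.clm_comp contDiffAt_const

theorem chartRight_chartOne [LieGroup 𝓘(K, E) 2 G] : chartRight K E G (chartOne K E G) = 1 := by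
  have h := hasFDerivAt_chartMul_left (eventually_differentiableAt_chartMul (K := K) (E := E)
    (G := G)).self_of_nhds
  refine h.unique ((hasFDerivAt_id (chartOne K E G)).congr_of_eventuallyEq ?_)
  filter_upwards [chart_target_mem_nhds (K := K) (E := E) (G := G)] with y hy
  exact chartMul_chartOne_right hy

theorem chartLeft_chartOne [LieGroup 𝓘(K, E) 2 G] : chartLeft K E G (chartOne K E G) = 1 := by
  have h := hasFDerivAt_chartMul_right (eventually_differentiableAt_chartMul (K := K) (E := E)
    (G := G)).self_of_nhds
  refine h.unique ((hasFDerivAt_id (chartOne K E G)).congr_of_eventuallyEq ?_)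
  filter_upwards [chart_target_mem_nhds (K := K) (E := E) (G := G)] with y hy
  exact chartMul_chartOne_left hy

/-- Differentiate `g x = (g x g⁻¹) g` in `x` at `1`. As the one-sided translations are partial
derivatives of the multiplication, this identity makes `Ad` a `C¹` function of `g`, which its
definition as a derivative for each fixed `g` does not show. -/
theorem eventually_chartRight_comp_Ad [LieGroup 𝓘(K, E) 2 G] :
    ∀ᶠ y in 𝓝 (chartOne K E G),
      (chartRight K E G y).toLinearMap ∘ₗ Ad K E ((extChartAt 𝓘(K, E) (1 : G)).symm y) =
        (chartLeft K E G y).toLinearMap := by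
  have : LieGroup 𝓘(K, E) 1 G := LieGroup.of_le (n := 2) (by norm_num)
  have hd := eventually_differentiableAt_chartMul (K := K) (E := E) (G := G)
  filter_upwards [tendsto_prodMk_chartOne_left.eventually hd,
    tendsto_prodMk_chartOne_right.eventually hd] with y h1 h2
  have hc := differentiableAt_chartConj (K := K) (E := E) ((extChartAt 𝓘(K, E) (1 : G)).symm y)
  have hl := hasFDerivAt_chartMul_left h1
  rw [← chartConj_chartOne ((extChartAt 𝓘(K, E) (1 : G)).symm y)] at hl
  have hcomp := hl.comp (chartOne K E G) hc.hasFDerivAt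
  have heq := (hasFDerivAt_chartMul_right h2).unique (hcomp.congr_of_eventuallyEq ?_)
  · rw [Ad_eq_fderiv, heq]
    rfl
  · filter_upwards [chart_symm_chartConj (K := K) (E := E)
      ((extChartAt 𝓘(K, E) (1 : G)).symm y)] with z hz
    simp only [Function.comp, chartMul]
    rw [hz]
    simp

theorem eventually_isUnit_chartRight [FiniteDimensional K E] [LieGroup 𝓘(K, E) 2 G] :
    ∀ᶠ y in 𝓝 (chartOne K E G), IsUnit (chartRight K E G y) := by
  have : CompleteSpace E := FiniteDimensional.complete K E
  refine (contDiffAt_chartRight (K := K) (E := E) (G := G)).continuousAt.eventually_mem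
    (s := {x | IsUnit x}) ?_
  rw [chartRight_chartOne]
  exact Units.isOpen.mem_nhds isUnit_one

/-- `Ring.inverse` is a true inverse only at units; near the identity the right translations are
invertible because they are close to `1`. -/
theorem eventually_Ad_eq_chartAd [FiniteDimensional K E] [LieGroup 𝓘(K, E) 2 G] :
    ∀ᶠ y in 𝓝 (chartOne K E G),
      Ad K E ((extChartAt 𝓘(K, E) (1 : G)).symm y) = (chartAd K E G y).toLinearMap := by
  filter_upwards [eventually_chartRight_comp_Ad (K := K) (E := E) (G := G),
    eventually_isUnit_chartRight (K := K) (E := E) (G := G)] with y h1 h2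
  ext v
  have h := LinearMap.congr_fun h1 v
  change chartRight K E G y (Ad K E _ v) = chartLeft K E G y v at h
  change _ = Ring.inverse (chartRight K E G y) (chartLeft K E G y v)
  rw [← h]
  exact (DFunLike.congr_fun (Ring.inverse_mul_cancel _ h2) (Ad K E _ v)).symm

theorem contDiffAt_chartAd [FiniteDimensional K E] [LieGroup 𝓘(K, E) 2 G] :
    ContDiffAt K 1 (chartAd K E G) (chartOne K E G) := by
  have : CompleteSpace E := FiniteDimensional.complete K E
  have h1 : ContDiffAt K 1 (Ring.inverse : (E →L[K] E) → (E →L[K] E))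
      (chartRight K E G (chartOne K E G)) := by
    rw [chartRight_chartOne]
    exact contDiffAt_ringInverse K (1 : (E →L[K] E)ˣ)
  have h2 : ContDiffAt K 1 (fun y => Ring.inverse (chartRight K E G y)) (chartOne K E G) :=
    h1.comp (chartOne K E G) contDiffAt_chartRight
  exact h2.clm_comp contDiffAt_chartLeft

theorem chartAd_chartOne [LieGroup 𝓘(K, E) 2 G] : chartAd K E G (chartOne K E G) = 1 := by
  rw [chartAd, chartRight_chartOne, chartLeft_chartOne]
  simp

/-- Product rule for `left = right ∘ Ad` at the identity, where all three factors are `1`. -/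
theorem fderiv_chartAd_chartOne [FiniteDimensional K E] [LieGroup 𝓘(K, E) 2 G] (v w : E) :
    fderiv K (chartAd K E G) (chartOne K E G) v w =
      fderiv K (chartLeft K E G) (chartOne K E G) v w -
        fderiv K (chartRight K E G) (chartOne K E G) v w := by
  have hA := (contDiffAt_chartAd (K := K) (E := E) (G := G)).differentiableAt one_ne_zero
  have hR := (contDiffAt_chartRight (K := K) (E := E) (G := G)).differentiableAt one_ne_zero
  have hL := (contDiffAt_chartLeft (K := K) (E := E) (G := G)).differentiableAt one_ne_zero
  have heq : (chartLeft K E G) =ᶠ[𝓝 (chartOne K E G)]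
      fun y => (chartRight K E G y).comp (chartAd K E G y) := by
    filter_upwards [eventually_isUnit_chartRight (K := K) (E := E) (G := G)] with y hy
    change _ = chartRight K E G y * chartAd K E G y
    rw [chartAd, ← mul_assoc, Ring.mul_inverse_cancel _ hy, one_mul]
  have h := hL.hasFDerivAt.unique
    ((hR.hasFDerivAt.clm_comp hA.hasFDerivAt).congr_of_eventuallyEq heq)
  rw [h, chartAd_chartOne, chartRight_chartOne]
  simp

theorem fderiv_chartLeft_apply [LieGroup 𝓘(K, E) 2 G] (v w : E) :
    fderiv K (chartLeft K E G) (chartOne K E G) v w =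
      fderiv K (fderiv K (chartMul K E G)) (chartOne K E G, chartOne K E G) (v, 0) (0, w) := by
  have hd := (contDiffAt_fderiv_chartMul (K := K) (E := E) (G := G)).differentiableAt one_ne_zero
  have h := (HasFDerivAt.comp (f := fun y => (y, chartOne K E G)) (chartOne K E G) hd.hasFDerivAt
    (hasFDerivAt_prodMk_left (chartOne K E G) (chartOne K E G))).clm_comp
      (hasFDerivAt_const (ContinuousLinearMap.inr K E E) (chartOne K E G))
  have h' : fderiv K (chartLeft K E G) (chartOne K E G) = _ := h.fderiv
  rw [h']
  simp

/-- Both sides are mixed second derivatives of the multiplication; they agree by symmetry, which is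
where `C²` is needed. -/
theorem fderiv_chartRight_apply [LieGroup 𝓘(K, E) 2 G] (v w : E) :
    fderiv K (chartRight K E G) (chartOne K E G) v w =
      fderiv K (chartLeft K E G) (chartOne K E G) w v := by
  have hd := (contDiffAt_fderiv_chartMul (K := K) (E := E) (G := G)).differentiableAt one_ne_zero
  have h := (hd.hasFDerivAt.comp (chartOne K E G)
    (hasFDerivAt_prodMk_right (chartOne K E G) (chartOne K E G))).clm_comp
      (hasFDerivAt_const (ContinuousLinearMap.inl K E E) (chartOne K E G))
  have h' : fderiv K (chartRight K E G) (chartOne K E G) = _ := h.fderiv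
  rw [h', fderiv_chartLeft_apply]
  have hs := (contDiffAt_chartMul_chartOne (K := K) (E := E) (G := G) (n := 2)).isSymmSndFDerivAt
    (by simp)
  rw [hs.eq]
  simp

/-- The left-invariant field at `g` is the derivative of `x ↦ g x`, and pulling it back composes it
with the derivative of the chart; by the chain rule this is the left translation read in the chart.
It turns the bracket of left-invariant fields into a computation in `E`. -/
theorem mpullback_mulInvariantVectorField_chart [LieGroup 𝓘(K, E) 2 G] (v : E) :
    ∀ᶠ y in 𝓝 (chartOne K E G),
      VectorField.mpullbackWithin 𝓘(K, E) 𝓘(K, E) (extChartAt 𝓘(K, E) (1 : G)).symm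
        (mulInvariantVectorField (I := 𝓘(K, E)) (G := G) v) (Set.range 𝓘(K, E)) y =
      chartLeft K E G y v := by
  have hman : IsManifold 𝓘(K, E) 1 G := IsManifold.of_le (n := 2) (by norm_num)
  have hd := eventually_differentiableAt_chartMul (K := K) (E := E) (G := G)
  filter_upwards [tendsto_prodMk_chartOne_right.eventually hd,
    chart_target_mem_nhds (K := K) (E := E) (G := G)] with y h2 hy
  set g : G := (extChartAt 𝓘(K, E) (1 : G)).symm y with hg
  have hgs : g ∈ (extChartAt 𝓘(K, E) (1 : G)).source := (extChartAt 𝓘(K, E) (1 : G)).map_target hy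
  have hinv : (mfderivWithin 𝓘(K, E) 𝓘(K, E) (extChartAt 𝓘(K, E) (1 : G)).symm
      (Set.range 𝓘(K, E)) y).inverse = mfderiv 𝓘(K, E) 𝓘(K, E) (extChartAt 𝓘(K, E) (1 : G)) g := by
    apply ContinuousLinearMap.inverse_eq
    · exact mfderivWithin_extChartAt_symm_comp_mfderiv_extChartAt hy
    · exact mfderiv_extChartAt_comp_mfderivWithin_extChartAt_symm hy
  have hLd : MDifferentiableAt 𝓘(K, E) 𝓘(K, E) (fun x : G => g * x) 1 :=
    (contMDiff_mul_left (n := 2)).contMDiffAt.mdifferentiableAt (by norm_num)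
  have hchart : MDifferentiableAt 𝓘(K, E) 𝓘(K, E) (extChartAt 𝓘(K, E) (1 : G)) (g * 1) := by
    rw [mul_one]
    exact (contMDiffAt_chart (n := 1) hgs).mdifferentiableAt one_ne_zero
  have hcomp := mfderiv_comp (I' := 𝓘(K, E)) (1 : G) hchart hLd
  have hfd := mfderiv_eq_fderiv_chart (K := K)
    ((extChartAt 𝓘(K, E) (1 : G)) ∘ fun x : G => g * x) rfl (hchart.comp (1 : G) hLd)
  have hm : (mfderiv 𝓘(K, E) 𝓘(K, E) (extChartAt 𝓘(K, E) (1 : G)) (g * 1) : E →L[K] E) =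
      (mfderiv 𝓘(K, E) 𝓘(K, E) (extChartAt 𝓘(K, E) (1 : G)) g : E →L[K] E) := by
    rw [mul_one]
  have hl : fderiv K (chartMul K E G ∘ fun z => (y, z)) (chartOne K E G) = chartLeft K E G y :=
    (hasFDerivAt_chartMul_right h2).fderiv
  rw [VectorField.mpullbackWithin_apply, hinv, ← hl]
  rw [extChartAt_self_eq] at hfd
  have hfd' := DFunLike.congr_fun hfd v
  have hcomp' := DFunLike.congr_fun hcomp v
  have hm' := DFunLike.congr_fun hm (mfderiv 𝓘(K, E) 𝓘(K, E) (fun x : G => g * x) 1 v : E)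
  exact hm'.symm.trans (hcomp'.symm.trans hfd')

theorem mfderiv_chart_one [IsManifold 𝓘(K, E) 1 G] :
    (mfderiv 𝓘(K, E) 𝓘(K, E) (extChartAt 𝓘(K, E) (1 : G)) 1 : E →L[K] E) =
      ContinuousLinearMap.id K E := by
  rw [mfderiv_eq_fderiv_chart (K := K) (extChartAt 𝓘(K, E) (1 : G)) rfl
    ((contMDiffAt_chart (n := 1) (mem_extChartAt_source 1)).mdifferentiableAt one_ne_zero),
    ← fderiv_id (𝕜 := K) (x := chartOne K E G)]
  apply Filter.EventuallyEq.fderiv_eq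
  filter_upwards [chart_target_mem_nhds (K := K) (E := E) (G := G)] with y hy
  rw [extChartAt_self_eq]
  exact (extChartAt 𝓘(K, E) (1 : G)).right_inv hy

theorem bracket_eq_chartLeft [LieGroup 𝓘(K, E) 2 G] (v w : GroupLieAlgebra 𝓘(K, E) G) :
    (⁅v, w⁆ : GroupLieAlgebra 𝓘(K, E) G) =
      fderiv K (chartLeft K E G) (chartOne K E G) (v : E) (w : E) -
        fderiv K (chartLeft K E G) (chartOne K E G) (w : E) (v : E) := by
  have hman : IsManifold 𝓘(K, E) 1 G := IsManifold.of_le (n := 2) (by norm_num)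
  have hL := (contDiffAt_chartLeft (K := K) (E := E) (G := G)).differentiableAt one_ne_zero
  have hf : ∀ u : E, fderiv K (fun y => chartLeft K E G y u) (chartOne K E G) =
      (fderiv K (chartLeft K E G) (chartOne K E G)).flip u := fun u => by
    have := hL.hasFDerivAt.clm_apply (hasFDerivAt_const u (chartOne K E G))
    rw [this.fderiv]
    ext
    simp
  -- The bracket of fields on `G` is the bracket in the chart followed by the inverse of the
  -- derivative of the chart; at `1` that derivative is the identity.
  have hinv : ∀ T : E →L[K] E, T = ContinuousLinearMap.id K E → ∀ u, T.inverse u = u := by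
    rintro _ rfl u
    simp
  have h (v w : E) : VectorField.lieBracketWithin K
      (VectorField.mpullbackWithin 𝓘(K, E) 𝓘(K, E) (extChartAt 𝓘(K, E) (1 : G)).symm
        (mulInvariantVectorField (I := 𝓘(K, E)) (G := G) v) (Set.range 𝓘(K, E)))
      (VectorField.mpullbackWithin 𝓘(K, E) 𝓘(K, E) (extChartAt 𝓘(K, E) (1 : G)).symm
        (mulInvariantVectorField (I := 𝓘(K, E)) (G := G) w) (Set.range 𝓘(K, E)))
      ((extChartAt 𝓘(K, E) (1 : G)).symm ⁻¹' Set.univ ∩ Set.range 𝓘(K, E)) (chartOne K E G) =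
      fderiv K (chartLeft K E G) (chartOne K E G) v w -
        fderiv K (chartLeft K E G) (chartOne K E G) w v := by
    rw [Filter.EventuallyEq.lieBracketWithin_vectorField_eq_nhds
      (mpullback_mulInvariantVectorField_chart (K := K) (G := G) v)
      (mpullback_mulInvariantVectorField_chart (K := K) (G := G) w)]
    simp only [Set.preimage_univ, modelWithCornersSelf_coe, Set.range_id, Set.inter_univ,
      VectorField.lieBracketWithin_univ, VectorField.lieBracket]
    rw [hf, hf, chartLeft_chartOne]
    rfl
  exact (hinv _ mfderiv_chart_one _).trans (h v w)

theorem fderiv_chartAd_eq_bracket [FiniteDimensional K E] [LieGroup 𝓘(K, E) 2 G]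
    (v w : GroupLieAlgebra 𝓘(K, E) G) :
    (⁅v, w⁆ : GroupLieAlgebra 𝓘(K, E) G) =
      fderiv K (chartAd K E G) (chartOne K E G) (v : E) (w : E) := by
  have h (v w : E) : fderiv K (chartAd K E G) (chartOne K E G) v w =
      fderiv K (chartLeft K E G) (chartOne K E G) v w -
        fderiv K (chartLeft K E G) (chartOne K E G) w v := by
    rw [fderiv_chartAd_chartOne, fderiv_chartRight_apply]
  exact (bracket_eq_chartLeft v w).trans (h v w).symm

end AdDerivative

/-! ### Subspaces stable under the bracket are stable under `Ad` near the identity -/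

section AdInvariant

/-- A function that vanishes at a point and whose derivative is bounded by a multiple of the
function vanishes near that point. -/
theorem eventually_eq_zero_of_norm_fderiv_le {K E F : Type*} [RCLike K] [NormedAddCommGroup E]
    [NormedSpace K E] [NormedAddCommGroup F] [NormedSpace K F] {f : E → F} {o : E} {C : ℝ}
    (hf : ∀ᶠ y in 𝓝 o, DifferentiableAt K f y ∧ ‖fderiv K f y‖ ≤ C * ‖f y‖) (h0 : f o = 0) :
    ∀ᶠ y in 𝓝 o, f y = 0 := by
  let _ : NormedSpace ℝ E := NormedSpace.restrictScalars ℝ K E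
  have hcont : ContinuousAt f o := hf.self_of_nhds.1.continuousAt
  have hsmall : ∀ᶠ y in 𝓝 o, ‖f y‖ ≤ 1 := by
    have h1 : ContinuousAt (fun y => ‖f y‖) o := hcont.norm
    have h2 : ‖f o‖ < 1 := by simp [h0]
    exact h1.eventually (ge_mem_nhds h2)
  obtain ⟨r₀, hr₀, hball⟩ := Metric.eventually_nhds_iff_ball.1 (hf.and hsmall)
  set C' : ℝ := max C 0
  have hC' : 0 ≤ C' := le_max_right _ _
  obtain ⟨r, hr, hrr, hrC⟩ : ∃ r : ℝ, 0 < r ∧ r ≤ r₀ ∧ C' * r ≤ 1 / 2 := by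
    -- With `C' r ≤ ½` each use of the mean value inequality on the ball halves the bound on `f`.
    -- The `+ 1` keeps the denominator positive when `C' = 0`.
    refine ⟨min r₀ (1 / (2 * (C' + 1))), by positivity, min_le_left _ _, ?_⟩
    calc C' * min r₀ (1 / (2 * (C' + 1))) ≤ C' * (1 / (2 * (C' + 1))) := by
          gcongr; exact min_le_right _ _
      _ ≤ 1 / 2 := by
          rw [mul_one_div, div_le_div_iff₀ (by positivity) (by norm_num)]
          linarith
  have hsub : Metric.ball o r ⊆ Metric.ball o r₀ := Metric.ball_subset_ball hrr
  have key : ∀ n : ℕ, ∀ y ∈ Metric.ball o r, ‖f y‖ ≤ (1 / 2) ^ n := by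
    intro n
    induction n with
    | zero => intro y hy; simpa using (hball y (hsub hy)).2
    | succ n ih =>
      intro y hy
      have hmv := Convex.norm_image_sub_le_of_norm_fderiv_le (𝕜 := K) (f := f)
        (C := C' * (1 / 2) ^ n) (s := Metric.ball o r)
        (fun x hx => (hball x (hsub hx)).1.1) (fun x hx => ?_) (convex_ball o r)
        (Metric.mem_ball_self hr) hy
      · rw [h0, sub_zero] at hmv
        rw [Metric.mem_ball, dist_eq_norm] at hy
        calc ‖f y‖ ≤ C' * (1 / 2) ^ n * ‖y - o‖ := hmv
          _ ≤ C' * (1 / 2) ^ n * r := by gcongr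
          _ = C' * r * (1 / 2) ^ n := by ring
          _ ≤ 1 / 2 * (1 / 2) ^ n := by gcongr
          _ = (1 / 2) ^ (n + 1) := by ring
      · calc ‖fderiv K f x‖ ≤ C * ‖f x‖ := (hball x (hsub hx)).1.2
          _ ≤ C' * ‖f x‖ := by gcongr; exact le_max_left _ _
          _ ≤ C' * (1 / 2) ^ n := by gcongr; exact ih x hx
  filter_upwards [Metric.ball_mem_nhds o hr] with y hy
  have hlim : Filter.Tendsto (fun n : ℕ => ((1 : ℝ) / 2) ^ n) Filter.atTop (𝓝 0) :=
    tendsto_pow_atTop_nhds_zero_of_lt_one (by norm_num) (by norm_num)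
  have := ge_of_tendsto' hlim fun n => key n y hy
  exact norm_le_zero_iff.1 this

variable {K : Type*} [RCLike K] {E : Type*} [NormedAddCommGroup E] [NormedSpace K E]
  {G : Type*} [TopologicalSpace G] [ChartedSpace E G] [Group G]

/-- Differentiate `Ad z = Ad g · Ad (g⁻¹ z)` at `z = g`: the derivative of `Ad` anywhere near `1` is
its derivative at `1`, multiplied on the left by `Ad g`. Here `T` is the derivative of `z ↦ g⁻¹ z`
in the chart. -/
theorem eventually_hasFDerivAt_chartAd [FiniteDimensional K E] [LieGroup 𝓘(K, E) 2 G] :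
    ∀ᶠ y in 𝓝 (chartOne K E G), ∃ T : E →L[K] E, ∀ v,
      DifferentiableAt K (chartAd K E G) y ∧ fderiv K (chartAd K E G) y v =
        chartAd K E G y * fderiv K (chartAd K E G) (chartOne K E G) (T v) := by
  have : LieGroup 𝓘(K, E) 1 G := LieGroup.of_le (n := 2) (by norm_num)
  have hAd := eventually_Ad_eq_chartAd (K := K) (E := E) (G := G)
  filter_upwards [hAd.eventually_nhds, chart_target_mem_nhds (K := K) (E := E) (G := G)] with y hA hy
  set g : G := (extChartAt 𝓘(K, E) (1 : G)).symm y with hg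
  let l : E → E := fun z => extChartAt 𝓘(K, E) (1 : G) (g⁻¹ * (extChartAt 𝓘(K, E) (1 : G)).symm z)
  have hmul : ContMDiffAt 𝓘(K, E) 𝓘(K, E) 1
      (fun z => g⁻¹ * (extChartAt 𝓘(K, E) (1 : G)).symm z) y :=
    ContMDiffAt.comp (I' := 𝓘(K, E)) y (contMDiff_mul_left (a := g⁻¹)).contMDiffAt
      (contMDiffAt_chart_symm hy)
  have hmuly : g⁻¹ * (extChartAt 𝓘(K, E) (1 : G)).symm y = 1 := inv_mul_cancel g
  have hl : DifferentiableAt K l y := by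
    have : ContMDiffAt 𝓘(K, E) 𝓘(K, E) 1 l y := by
      refine ContMDiffAt.comp (I' := 𝓘(K, E)) y (contMDiffAt_chart ?_) hmul
      rw [hmuly]
      exact mem_extChartAt_source 1
    exact (contMDiffAt_iff_contDiffAt.1 this).differentiableAt one_ne_zero
  have hly : l y = chartOne K E G := by simp only [l, hmuly, chartOne]
  have heq : chartAd K E G =ᶠ[𝓝 y] fun z => (chartAd K E G y).comp (chartAd K E G (l z)) := by
    have h1 := hmul.continuousAt.eventually_mem (s := (extChartAt 𝓘(K, E) (1 : G)).source)
      (by rw [hmuly]; exact extChartAt_source_mem_nhds (I := 𝓘(K, E)) (1 : G))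
    have h2 := hl.continuousAt.tendsto.eventually (p := fun z =>
      Ad K E ((extChartAt 𝓘(K, E) (1 : G)).symm z) = (chartAd K E G z).toLinearMap)
      (by rw [hly]; exact hAd)
    filter_upwards [hA, h1, h2] with z hz h1z h2z
    have h3 : (extChartAt 𝓘(K, E) (1 : G)).symm (l z) =
        g⁻¹ * (extChartAt 𝓘(K, E) (1 : G)).symm z := (extChartAt 𝓘(K, E) (1 : G)).left_inv h1z
    rw [h3] at h2z
    have h4 := Ad_mul (K := K) (E := E) g (g⁻¹ * (extChartAt 𝓘(K, E) (1 : G)).symm z)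
    rw [mul_inv_cancel_left, hz, h2z, hA.self_of_nhds] at h4
    ext v
    exact LinearMap.congr_fun h4 v
  have hA0 := (contDiffAt_chartAd (K := K) (E := E) (G := G)).differentiableAt one_ne_zero
  rw [← hly] at hA0
  have hcomp : HasFDerivAt (fun z => chartAd K E G (l z))
    ((fderiv K (chartAd K E G) (l y)).comp (fderiv K l y)) y :=
    HasFDerivAt.comp y hA0.hasFDerivAt hl.hasFDerivAt
  have hd := ((hasFDerivAt_const (chartAd K E G y) y).clm_comp hcomp).congr_of_eventuallyEq heq
  refine ⟨fderiv K l y, fun v => ⟨hd.differentiableAt, ?_⟩⟩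
  rw [hd.fderiv, hly]
  ext w
  simp

/-- The bound is uniform in `y`. No estimate of `w` itself is needed: the endomorphism `A'(1) w`
equals `A(y)⁻¹ A'(y) v`, and this is bounded because `A⁻¹` and `A'` are continuous at the identity.
-/
theorem eventually_exists_fderiv_chartAd_bound [FiniteDimensional K E] [LieGroup 𝓘(K, E) 2 G] :
    ∃ C : ℝ, 0 ≤ C ∧ ∀ᶠ y in 𝓝 (chartOne K E G), DifferentiableAt K (chartAd K E G) y ∧
      ∀ v, ∃ w, fderiv K (chartAd K E G) y v =
        chartAd K E G y * fderiv K (chartAd K E G) (chartOne K E G) w ∧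
        ‖fderiv K (chartAd K E G) (chartOne K E G) w‖ ≤ C * ‖v‖ := by
  have : CompleteSpace E := FiniteDimensional.complete K E
  have hA := contDiffAt_chartAd (K := K) (E := E) (G := G)
  have hinv : ContinuousAt (fun y => Ring.inverse (chartAd K E G y)) (chartOne K E G) := by
    refine ContinuousAt.comp (g := Ring.inverse) ?_ hA.continuousAt
    rw [chartAd_chartOne]
    exact (contDiffAt_ringInverse K (n := 0) (1 : (E →L[K] E)ˣ)).continuousAt
  have hder : ContinuousAt (fderiv K (chartAd K E G)) (chartOne K E G) :=
    (hA.fderiv_right (m := 0) (by norm_num)).continuousAt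
  have hunit : ∀ᶠ y in 𝓝 (chartOne K E G), IsUnit (chartAd K E G y) := by
    refine hA.continuousAt.eventually_mem (s := {x | IsUnit x}) ?_
    rw [chartAd_chartOne]
    exact Units.isOpen.mem_nhds isUnit_one
  have hdn : ContinuousAt (fun y => ‖fderiv K (chartAd K E G) y‖) (chartOne K E G) :=
    hder.norm (E := E →L[K] E →L[K] E)
  have hb : ContinuousAt (fun y => ‖Ring.inverse (chartAd K E G y)‖ * ‖fderiv K (chartAd K E G) y‖)
    (chartOne K E G) := hinv.norm.mul hdn
  refine ⟨‖Ring.inverse (chartAd K E G (chartOne K E G))‖ *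
    ‖fderiv K (chartAd K E G) (chartOne K E G)‖ + 1, by positivity, ?_⟩
  filter_upwards [hunit, hb.eventually (ge_mem_nhds (lt_add_one _)),
    eventually_hasFDerivAt_chartAd (K := K) (E := E) (G := G)] with y hu hby ⟨T, hT⟩
  refine ⟨(hT 0).1, fun v => ⟨T v, (hT v).2, ?_⟩⟩
  have h : fderiv K (chartAd K E G) (chartOne K E G) (T v) =
      Ring.inverse (chartAd K E G y) * fderiv K (chartAd K E G) y v := by
    rw [(hT v).2, ← mul_assoc, Ring.inverse_mul_cancel _ hu, one_mul]
  rw [h]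
  calc ‖Ring.inverse (chartAd K E G y) * fderiv K (chartAd K E G) y v‖
      ≤ ‖Ring.inverse (chartAd K E G y)‖ * (‖fderiv K (chartAd K E G) y‖ * ‖v‖) :=
        (norm_mul_le _ _).trans (by gcongr; exact ContinuousLinearMap.le_opNorm _ _)
    _ = ‖Ring.inverse (chartAd K E G y)‖ * ‖fderiv K (chartAd K E G) y‖ * ‖v‖ := by ring
    _ ≤ _ := by gcongr

theorem eventually_chartAd_mem [FiniteDimensional K E] [LieGroup 𝓘(K, E) 2 G]
    (U : Submodule K E)
    (hU : ∀ v, ∀ u ∈ U, fderiv K (chartAd K E G) (chartOne K E G) v u ∈ U) :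
    ∀ᶠ y in 𝓝 (chartOne K E G), ∀ u ∈ U, chartAd K E G y u ∈ U := by
  obtain ⟨p, hp⟩ := LinearMap.exists_leftInverse_of_injective U.subtype U.ker_subtype
  let π : E →L[K] E := LinearMap.toContinuousLinearMap (U.subtype ∘ₗ p)
  have hπ : ∀ u ∈ U, π u = u := fun u hu =>
    congrArg Subtype.val (LinearMap.congr_fun hp (⟨u, hu⟩ : U))
  have hπm : ∀ u, π u ∈ U := fun u => (p u).2
  obtain ⟨C, hC0, hC⟩ := eventually_exists_fderiv_chartAd_bound (K := K) (E := E) (G := G)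
  -- `f y` measures the failure of `A(y)` to preserve `U`. If `D = A'(1) w` preserves `U`, then `D π
  -- = π D π`, so `f'(y) v = (1 - π) A(y) D π = f(y) D π`: a linear equation with zero initial
  -- value.
  let f : E → E →L[K] E := fun y => (1 - π) * chartAd K E G y * π
  have hf0 : f (chartOne K E G) = 0 := by
    ext u
    simp [f, chartAd_chartOne, hπ _ (hπm u)]
  have hzero := eventually_eq_zero_of_norm_fderiv_le (K := K) (f := f) (o := chartOne K E G)
    (C := C * ‖π‖) (by
      filter_upwards [hC] with y ⟨hd, hv⟩
      have hf : HasFDerivAt f (((ContinuousLinearMap.compL K E E E).flip π).comp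
          ((ContinuousLinearMap.compL K E E E (1 - π)).comp (fderiv K (chartAd K E G) y))) y := by
        have h1 := (ContinuousLinearMap.compL K E E E (1 - π)).hasFDerivAt.comp y hd.hasFDerivAt
        exact ((ContinuousLinearMap.compL K E E E).flip π).hasFDerivAt.comp y h1
      refine ⟨hf.differentiableAt, ?_⟩
      rw [hf.fderiv]
      refine ContinuousLinearMap.opNorm_le_bound _ (by positivity) fun v => ?_
      obtain ⟨w, hw, hwb⟩ := hv v
      set D := fderiv K (chartAd K E G) (chartOne K E G) w with hD
      have hDπ : π * (D * π) = D * π := by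
        ext u
        exact hπ _ (hU w _ (hπm u))
      have heq : (1 - π) * (chartAd K E G y * D) * π = f y * (D * π) := by
        simp only [f]
        rw [mul_assoc _ π, hDπ]
        simp only [mul_assoc]
      calc ‖(1 - π) * fderiv K (chartAd K E G) y v * π‖ = ‖f y * (D * π)‖ := by rw [hw, heq]
        _ ≤ ‖f y‖ * ((C * ‖v‖) * ‖π‖) := by
          refine (norm_mul_le _ _).trans ?_
          gcongr
          refine (norm_mul_le _ _).trans ?_
          gcongr
        _ = C * ‖π‖ * ‖f y‖ * ‖v‖ := by ring) hf0
  filter_upwards [hzero] with y hy u hu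
  have h : chartAd K E G y (π u) - π (chartAd K E G y (π u)) = 0 := DFunLike.congr_fun hy u
  rw [hπ u hu, sub_eq_zero] at h
  rw [h]
  exact hπm _

end AdInvariant

/-! ### From a neighbourhood of the identity to a connected group -/

section Connected

variable {K : Type*} [RCLike K] {E : Type*} [NormedAddCommGroup E] [NormedSpace K E]
  {G : Type*} [TopologicalSpace G] [ChartedSpace E G] [Group G]

theorem Ad_mem_of_forall_bracket_mem [FiniteDimensional K E] [LieGroup 𝓘(K, E) 2 G]
    [ConnectedSpace G] (U : Submodule K (GroupLieAlgebra 𝓘(K, E) G))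
    (hU : ∀ X : GroupLieAlgebra 𝓘(K, E) G, ∀ Y ∈ U, ⁅X, Y⁆ ∈ U) (g : G) :
    ∀ Y ∈ U, Ad K E g Y ∈ U := by
  have : LieGroup 𝓘(K, E) 1 G := LieGroup.of_le (n := 2) (by norm_num)
  have : IsTopologicalGroup G := topologicalGroup_of_lieGroup 𝓘(K, E) 2
  have hW : {g : G | ∀ Y ∈ U, Ad K E g Y ∈ U} ∈ 𝓝 (1 : G) := by
    have h1 := eventually_chartAd_mem (K := K) (E := E) (G := G) U (fun v u hu => by
      have h := hU v u hu
      have h' := fderiv_chartAd_eq_bracket (K := K) (E := E) (G := G) v u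
      exact h' ▸ h)
    filter_upwards [mem_nhds_chart_symm_image
      (h1.and (eventually_Ad_eq_chartAd (K := K) (E := E) (G := G)))] with g hg
    obtain ⟨y, ⟨hy1, hy2⟩, rfl⟩ := hg
    intro Y hY
    rw [hy2]
    exact hy1 Y hY
  -- The condition on `g⁻¹` is built in so that the set is closed under inversion. An open subgroup
  -- is closed, hence everything by connectedness.
  let S : Subgroup G :=
    { carrier := {g | (∀ Y ∈ U, Ad K E g Y ∈ U) ∧ ∀ Y ∈ U, Ad K E g⁻¹ Y ∈ U}
      mul_mem' := by
        rintro a b ⟨ha, ha'⟩ ⟨hb, hb'⟩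
        refine ⟨fun Y hY => ?_, fun Y hY => ?_⟩
        · rw [Ad_mul]; exact ha _ (hb _ hY)
        · rw [mul_inv_rev, Ad_mul]; exact hb' _ (ha' _ hY)
      one_mem' := by
        refine ⟨fun Y hY => ?_, fun Y hY => ?_⟩
        · rw [Ad_one]; exact hY
        · rw [inv_one, Ad_one]; exact hY
      inv_mem' := by
        rintro a ⟨ha, ha'⟩
        exact ⟨ha', by rwa [inv_inv]⟩ }
  have hopen : IsOpen (S : Set G) := by
    apply S.isOpen_of_mem_nhds (g := 1)
    have hinv : Filter.Tendsto (fun x : G => x⁻¹) (𝓝 1) (𝓝 1) := by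
      simpa using (continuous_inv (G := G)).tendsto 1
    filter_upwards [hW, hinv hW] with x hx hx'
    exact ⟨hx, hx'⟩
  have huniv : (S : Set G) = Set.univ :=
    IsClopen.eq_univ ⟨S.isClosed_of_isOpen hopen, hopen⟩ ⟨1, S.one_mem⟩
  have hg : g ∈ (S : Set G) := huniv ▸ Set.mem_univ g
  exact hg.1

end Connected

namespace TodaData

/-! ### Root spaces, the trace form and the operator `r` on `𝔤` -/

section Finite

set_option linter.unusedSectionVars false

open LieAlgebra LieAlgebra.IsKilling LieModule

variable {K : Type*} [RCLike K] {L : Type*} [LieRing L] [LieAlgebra K L]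
  [FiniteDimensional K L] [LieAlgebra.IsSimple K L] {H : LieSubalgebra K L}
  [H.IsCartanSubalgebra] [LieModule.IsTriangularizable K H L]
  {W : Type*} [AddCommGroup W] [Module K W] [LieRingModule L W] [LieModule K L W] {s : ℕ}

variable (W) in
-- Invariance of the form under `t ∈ H` gives `(χ₁ + χ₂)(t) · tr(xy) = 0`.
theorem traceForm_eq_zero_of_mem_rootSpace {χ₁ χ₂ : H → K} {x y : L} (hx : x ∈ rootSpace H χ₁)
    (hy : y ∈ rootSpace H χ₂) (h : χ₁ + χ₂ ≠ 0) : traceForm K L W x y = 0 := by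
  obtain ⟨t, ht⟩ := Function.ne_iff.1 h
  have h1 := traceForm_apply_lie_apply K L W x (t : L) y
  have hx' : ⁅(t : L), x⁆ = χ₁ t • x := lie_eq_smul_of_mem_rootSpace hx t
  have hy' : ⁅(t : L), y⁆ = χ₂ t • y := lie_eq_smul_of_mem_rootSpace hy t
  rw [← lie_skew, hx', hy'] at h1
  simp only [map_neg, map_smul, LinearMap.neg_apply, LinearMap.smul_apply, smul_eq_mul] at h1
  have h2 : (χ₁ t + χ₂ t) * traceForm K L W x y = 0 := by linear_combination -h1
  exact (mul_eq_zero.1 h2).resolve_left ht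

theorem mem_rootSpace_zero {x : L} (hx : x ∈ H) : x ∈ rootSpace H (0 : H → K) :=
  toLieSubmodule_le_rootSpace_zero K L H hx

theorem mem_of_mem_rootSpace_zero {x : L} (hx : x ∈ rootSpace H (0 : H → K)) : x ∈ H := by
  rwa [rootSpace_zero_eq] at hx

theorem root_coe_ne_zero (α : H.root) : ((α : Weight K H L) : H → K) ≠ 0 :=
  H.isNonZero_coe_root α

theorem exists_root_of_mem_rootSpace {χ : H → K} (hχ : χ ≠ 0) {x : L} (hx : x ∈ rootSpace H χ)
    (hx0 : x ≠ 0) : ∃ γ : H.root, ((γ : Weight K H L) : H → K) = χ := by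
  have hne : genWeightSpace L χ ≠ ⊥ := fun h => hx0 (by
    have : x ∈ genWeightSpace L χ := hx
    rw [h] at this
    exact (LieSubmodule.mem_bot x).1 this)
  refine ⟨⟨⟨χ, hne⟩, ?_⟩, rfl⟩
  exact Finset.mem_filter.2 ⟨Finset.mem_univ _, hχ⟩

theorem root_eq_iff (α : H.root) (β : H.root) :
    ((α : Weight K H L) : H → K) = ((β : Weight K H L) : H → K) ↔ α = β := by
  constructor
  · intro h
    exact Subtype.ext (DFunLike.coe_injective h)
  · rintro rfl; rfl

variable (D : TodaData K L H W s)

theorem root_eq_add {α β γ : H.root}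
    (h : ((γ : Weight K H L) : H → K) = (α : Weight K H L) + (β : Weight K H L)) :
    (rootSystem H).root γ = (rootSystem H).root α + (rootSystem H).root β := by
  ext t
  simpa using congrFun h t

theorem root_eq_sub {α β γ : H.root}
    (h : ((γ : Weight K H L) : H → K) = (α : Weight K H L) - (β : Weight K H L)) :
    (rootSystem H).root γ = (rootSystem H).root α - (rootSystem H).root β := by
  ext t
  simpa using congrFun h t

theorem root_add_ne_zero {α β : H.root} (hα : D.base.IsPos α) (hβ : D.base.IsPos β) :
    ((α : Weight K H L) : H → K) + (β : Weight K H L) ≠ 0 := by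
  intro h
  -- If `α = -β`, then `α = β + 2α`; taking heights gives `ht α + ht β = 0`, against positivity of
  -- both.
  have h1 : (rootSystem H).root α = (rootSystem H).root β + (2 : ℤ) • (rootSystem H).root α := by
    ext t
    have := congrFun h t
    simp only [Pi.add_apply, Pi.zero_apply] at this
    simp
    linear_combination -this
  have h2 := D.base.height_add_zsmul h1
  rw [RootPairing.Base.isPos_iff] at hα hβ
  simp only [smul_eq_mul] at h2
  omega

theorem exists_root_eq_neg (γ : H.root) : ∃ β : H.root,
    ((β : Weight K H L) : H → K) = -(γ : Weight K H L) ∧ (D.base.IsPos γ ∨ D.base.IsPos β) := by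
  let _ := (rootSystem H).indexNeg
  refine ⟨-γ, ?_, RootPairing.Base.IsPos.or_neg D.base γ⟩
  have h1 : (rootSystem H).root (-γ) = -(rootSystem H).root γ := by
    rw [RootPairing.indexNeg_neg, RootPairing.root_reflectionPerm,
      RootPairing.reflection_apply_self]
  ext t
  exact LinearMap.congr_fun h1 t

theorem isPos_or_exists_neg (γ : H.root) : D.base.IsPos γ ∨
    ∃ β : H.root, D.base.IsPos β ∧ ((γ : Weight K H L) : H → K) = -(β : Weight K H L) := by
  obtain ⟨β, hβ, h | h⟩ := D.exists_root_eq_neg γ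
  · exact Or.inl h
  · exact Or.inr ⟨β, h, by rw [hβ, neg_neg]⟩

theorem eq_top_of_rootSpace_le (S : Submodule K L) (hH : ∀ x ∈ H, x ∈ S)
    (hpos : ∀ α : H.root, D.base.IsPos α → ∀ x ∈ rootSpace H (α : Weight K H L), x ∈ S)
    (hneg : ∀ α : H.root, D.base.IsPos α →
      ∀ x ∈ rootSpace H (-(α : Weight K H L) : H → K), x ∈ S) : S = ⊤ := by
  have h := congrArg LieSubmodule.toSubmodule (iSup_genWeightSpace_eq_top' K H L)
  rw [LieSubmodule.iSup_toSubmodule, LieSubmodule.top_toSubmodule] at h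
  rw [eq_top_iff, ← h]
  refine iSup_le fun χ x hx => ?_
  by_cases hχ : (χ : H → K) = 0
  · apply hH
    apply mem_of_mem_rootSpace_zero
    rw [← hχ]
    exact hx
  · by_cases hx0 : x = 0
    · rw [hx0]; exact S.zero_mem
    obtain ⟨γ, hγ⟩ := exists_root_of_mem_rootSpace hχ hx hx0
    rcases D.isPos_or_exists_neg γ with hp | ⟨β, hp, hβ⟩
    · exact hpos γ hp x (by rw [hγ]; exact hx)
    · exact hneg β hp x (by rw [← hβ, hγ]; exact hx)

/-- The operator on `𝔤` that is `½`, `0`, `-½` on the positive root spaces, the Cartan subalgebra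
and the negative root spaces. -/
def rOp : L →ₗ[K] L :=
  (1 / 2 : K) • ∑ α ∈ D.posRoots,
    ((traceForm K L W (D.f α)).smulRight (D.e α) - (traceForm K L W (D.e α)).smulRight (D.f α))

theorem rOp_apply (x : L) : D.rOp x = (1 / 2 : K) • ∑ α ∈ D.posRoots,
    (traceForm K L W (D.f α) x • D.e α - traceForm K L W (D.e α) x • D.f α) := by
  simp [rOp]

theorem mem_posRoots {α : H.root} : α ∈ D.posRoots ↔ D.base.IsPos α := by
  simp [posRoots]

/-- The tensor `∑ (e_α ⊗ f_α - f_α ⊗ e_α)` is skew, so the operator obtained by contraction is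
skew-adjoint. -/
theorem traceForm_rOp (x y : L) :
    traceForm K L W (D.rOp x) y = -traceForm K L W x (D.rOp y) := by
  rw [rOp_apply, rOp_apply]
  simp only [map_smul, LinearMap.smul_apply, map_sum, map_sub, LinearMap.sum_apply,
    LinearMap.sub_apply, smul_eq_mul]
  rw [← mul_neg, ← Finset.sum_neg_distrib]
  congr 1
  refine Finset.sum_congr rfl fun α _ => ?_
  rw [traceForm_comm K L W x (D.e α), traceForm_comm K L W x (D.f α)]
  ring

theorem rOp_of_mem_cartan {x : L} (hx : x ∈ H) : D.rOp x = 0 := by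
  rw [rOp_apply, Finset.sum_eq_zero, smul_zero]
  intro α hα
  rw [mem_posRoots] at hα
  rw [traceForm_eq_zero_of_mem_rootSpace W (D.f_mem α hα) (mem_rootSpace_zero hx),
    traceForm_eq_zero_of_mem_rootSpace W (D.e_mem α hα) (mem_rootSpace_zero hx)]
  · simp
  · rw [add_zero]; exact root_coe_ne_zero α
  · rw [add_zero, neg_ne_zero]; exact root_coe_ne_zero α

theorem traceForm_e_e {α β : H.root} (hα : D.base.IsPos α) (hβ : D.base.IsPos β) :
    traceForm K L W (D.e α) (D.e β) = 0 :=
  traceForm_eq_zero_of_mem_rootSpace W (D.e_mem α hα) (D.e_mem β hβ) (D.root_add_ne_zero hα hβ)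

theorem traceForm_f_f {α β : H.root} (hα : D.base.IsPos α) (hβ : D.base.IsPos β) :
    traceForm K L W (D.f α) (D.f β) = 0 :=
  traceForm_eq_zero_of_mem_rootSpace W (D.f_mem α hα) (D.f_mem β hβ)
    (by rw [← neg_add, neg_ne_zero]; exact D.root_add_ne_zero hα hβ)

theorem traceForm_e_f {α β : H.root} (hα : D.base.IsPos α) (hβ : D.base.IsPos β) (h : α ≠ β) :
    traceForm K L W (D.e α) (D.f β) = 0 :=
  traceForm_eq_zero_of_mem_rootSpace W (D.e_mem α hα) (D.f_mem β hβ)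
    (by rwa [← sub_eq_add_neg, sub_ne_zero, Ne, root_eq_iff])

theorem rOp_e {α : H.root} (hα : D.base.IsPos α) : D.rOp (D.e α) = (1 / 2 : K) • D.e α := by
  rw [rOp_apply, Finset.sum_eq_single α]
  · rw [D.traceForm_e_e hα hα, traceForm_comm, D.trace_e_f α hα]
    simp
  · intro β hβ hne
    rw [mem_posRoots] at hβ
    rw [D.traceForm_e_e hβ hα, traceForm_comm, D.traceForm_e_f hα hβ hne.symm]
    simp
  · intro h
    exact absurd (D.mem_posRoots.2 hα) h

theorem rOp_f {α : H.root} (hα : D.base.IsPos α) : D.rOp (D.f α) = -((1 / 2 : K) • D.f α) := by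
  rw [rOp_apply, Finset.sum_eq_single α]
  · rw [D.traceForm_f_f hα hα, D.trace_e_f α hα]
    simp
  · intro β hβ hne
    rw [mem_posRoots] at hβ
    rw [D.traceForm_f_f hβ hα, D.traceForm_e_f hβ hα hne]
    simp
  · intro h
    exact absurd (D.mem_posRoots.2 hα) h

theorem e_ne_zero {α : H.root} (hα : D.base.IsPos α) : D.e α ≠ 0 := by
  intro h
  simpa [h] using D.trace_e_f α hα

theorem f_ne_zero {α : H.root} (hα : D.base.IsPos α) : D.f α ≠ 0 := by
  intro h
  simpa [h] using D.trace_e_f α hα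

theorem exists_smul_e {α : H.root} (hα : D.base.IsPos α) {x : L}
    (hx : x ∈ rootSpace H (α : Weight K H L)) : ∃ c : K, c • D.e α = x := by
  have h1 := finrank_rootSpace_eq_one (α : Weight K H L) (H.isNonZero_coe_root α)
  have h2 := (finrank_eq_one_iff_of_nonzero'
    (⟨D.e α, D.e_mem α hα⟩ : rootSpace H (α : Weight K H L))
    (fun h => D.e_ne_zero hα (congrArg Subtype.val h))).1 h1
  obtain ⟨c, hc⟩ := h2 ⟨x, hx⟩
  exact ⟨c, congrArg Subtype.val hc⟩

theorem exists_smul_f {α : H.root} (hα : D.base.IsPos α) {x : L}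
    (hx : x ∈ rootSpace H (-(α : Weight K H L) : H → K)) : ∃ c : K, c • D.f α = x := by
  have h1 := finrank_rootSpace_eq_one (-(α : Weight K H L)) (H.isNonZero_coe_root α).neg
  have h2 := (finrank_eq_one_iff_of_nonzero'
    (⟨D.f α, D.f_mem α hα⟩ : rootSpace H (-(α : Weight K H L) : Weight K H L))
    (fun h => D.f_ne_zero hα (congrArg Subtype.val h))).1 h1
  obtain ⟨c, hc⟩ := h2 ⟨x, hx⟩
  exact ⟨c, congrArg Subtype.val hc⟩

/-- The functional `χ` need not be a root: if it is not, its root space is zero. This lets `α + β`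
and `β - α` be treated without deciding whether they are roots. If it is a root, the space is the
line through `e_γ`. -/
theorem rOp_of_pos {χ : H → K} (hχ : χ ≠ 0)
    (hpos : ∀ γ : H.root, ((γ : Weight K H L) : H → K) = χ → D.base.IsPos γ) {x : L}
    (hx : x ∈ rootSpace H χ) : D.rOp x = (1 / 2 : K) • x := by
  by_cases hx0 : x = 0
  · simp [hx0]
  obtain ⟨γ, rfl⟩ := exists_root_of_mem_rootSpace hχ hx hx0
  obtain ⟨c, rfl⟩ := D.exists_smul_e (hpos γ rfl) hx
  rw [map_smul, D.rOp_e (hpos γ rfl), smul_comm]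

theorem rOp_of_neg {χ : H → K} (hχ : χ ≠ 0)
    (hpos : ∀ γ : H.root, ((γ : Weight K H L) : H → K) = χ → D.base.IsPos γ) {x : L}
    (hx : x ∈ rootSpace H (-χ)) : D.rOp x = -((1 / 2 : K) • x) := by
  by_cases hx0 : x = 0
  · simp [hx0]
  obtain ⟨γ, hγ⟩ := exists_root_of_mem_rootSpace (neg_ne_zero.2 hχ) hx hx0
  rcases D.isPos_or_exists_neg γ with hp | ⟨β, hp, hβ⟩
  · obtain ⟨β, hβ, -⟩ := D.exists_root_eq_neg γ
    have h2 : ((β : Weight K H L) : H → K) = χ := by rw [hβ, hγ, neg_neg]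
    have h5 := D.root_add_ne_zero hp (hpos _ h2)
    rw [h2, hγ] at h5
    simp at h5
  · have h2 : ((β : Weight K H L) : H → K) = χ := by
      rw [hγ] at hβ
      exact (neg_injective hβ).symm
    subst h2
    obtain ⟨c, rfl⟩ := D.exists_smul_f (hpos β rfl) hx
    rw [map_smul, D.rOp_f (hpos β rfl), smul_neg, smul_comm]

end Finite

end TodaData

namespace TodaData

/-! ### The infinitesimal coadjoint action on `𝔤` -/

section FiniteCoadjoint

open LieAlgebra LieAlgebra.IsKilling LieModule

set_option linter.unusedSectionVars false

variable {K : Type*} [RCLike K] {L : Type*} [LieRing L] [LieAlgebra K L]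
  [FiniteDimensional K L] [LieAlgebra.IsSimple K L] {H : LieSubalgebra K L}
  [H.IsCartanSubalgebra] [LieModule.IsTriangularizable K H L]
  {W : Type*} [AddCommGroup W] [Module K W] [LieRingModule L W] [LieModule K L W] {s : ℕ}
  (D : TodaData K L H W s)

/-- The infinitesimal coadjoint action of `𝔤` with the bracket `[rx, y] + [x, ry]`. -/
def coad : L →ₗ[K] L →ₗ[K] L :=
  LinearMap.mk₂ K (fun y v => ⁅v, D.rOp y⁆ - D.rOp ⁅v, y⁆)
    (fun y y' v => by simp only [map_add, lie_add]; abel)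
    (fun c y v => by simp only [map_smul, lie_smul, smul_sub])
    (fun y v v' => by simp only [map_add, add_lie]; abel)
    (fun c y v => by simp only [map_smul, smul_lie, smul_sub])

theorem coad_apply (y v : L) : D.coad y v = ⁅v, D.rOp y⁆ - D.rOp ⁅v, y⁆ := rfl

/-- Thus `coad y` is the transpose of `[y, ·]_r`, which is minus the derivative of the coadjoint
action; the sign affects neither stable subspaces nor images. The identity follows from invariance
of the form and skewness of `r`. -/
theorem traceForm_coad (y z v : L) :
    traceForm K L W (⁅D.rOp y, z⁆ + ⁅y, D.rOp z⁆) v = traceForm K L W z (D.coad y v) := by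
  rw [coad_apply, map_sub, map_add, LinearMap.add_apply, ← neg_eq_iff_eq_neg.2 (D.traceForm_rOp z _),
    ← lie_skew, ← lie_skew y, map_neg, map_neg, LinearMap.neg_apply, LinearMap.neg_apply,
    traceForm_apply_lie_apply, traceForm_apply_lie_apply, ← lie_skew v, ← lie_skew v, map_neg,
    map_neg]
  ring

/-- The span of the `h_i` and of the `e_α + f_α` for simple `α`. -/
def todaSpan : Submodule K L :=
  Submodule.span K ({v | ∃ i : Fin s, v = (D.h i : L)} ∪
    {v | ∃ α ∈ D.base.support, v = D.e α + D.f α})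

theorem ef_mem_todaSpan {α : H.root} (hα : α ∈ D.base.support) : D.e α + D.f α ∈ D.todaSpan :=
  Submodule.subset_span (Or.inr ⟨α, hα, rfl⟩)

theorem cartan_mem_todaSpan {x : L} (hx : x ∈ H) : x ∈ D.todaSpan := by
  have h : (⊤ : Submodule K H) ≤ D.todaSpan.comap H.toSubmodule.subtype := by
    rw [← D.h.span_eq, Submodule.span_le]
    rintro _ ⟨i, rfl⟩
    exact Submodule.subset_span (Or.inl ⟨i, rfl⟩)
  exact h (x := ⟨x, hx⟩) trivial

theorem lie_eq_zero_of_mem_cartan {x y : L} (hx : x ∈ H) (hy : y ∈ H) : ⁅x, y⁆ = 0 := by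
  have := lie_eq_smul_of_mem_rootSpace (mem_rootSpace_zero hy) ⟨x, hx⟩
  simpa using! this

theorem lie_mem_rootSpace {χ₁ χ₂ χ : H → K} {x y : L} (hx : x ∈ rootSpace H χ₁)
    (hy : y ∈ rootSpace H χ₂) (h : χ = χ₁ + χ₂) : ⁅x, y⁆ ∈ rootSpace H χ := by
  rw [h]
  exact lie_mem_genWeightSpace_of_mem_genWeightSpace hx hy

theorem coad_eq_zero {y v : L} {c : K} (h1 : D.rOp y = c • y) (h2 : D.rOp ⁅v, y⁆ = c • ⁅v, y⁆) :
    D.coad y v = 0 := by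
  rw [coad_apply, h1, h2, lie_smul, sub_self]

/-- Both `ad t` and `r` change sign between `e_α` and `f_α`, so `r ∘ ad t` acts on the two by the
same scalar. -/
theorem coad_cartan_ef {α : H.root} (hα : D.base.IsPos α) (t : H) :
    D.coad t (D.e α + D.f α) =
      ((1 / 2 : K) * (α : Weight K H L) t) • (D.e α + D.f α) := by
  have he : ⁅(t : L), D.e α⁆ = (α : Weight K H L) t • D.e α :=
    lie_eq_smul_of_mem_rootSpace (D.e_mem α hα) t
  have hf : ⁅(t : L), D.f α⁆ = (-(α : Weight K H L) t) • D.f α :=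
    lie_eq_smul_of_mem_rootSpace (D.f_mem α hα) t
  rw [coad_apply, D.rOp_of_mem_cartan t.2, lie_zero, ← lie_skew, lie_add, he, hf, map_neg, map_add,
    map_smul, map_smul, D.rOp_e hα, D.rOp_f hα]
  module

-- The `e_α` part cancels because `α + β` cannot be a negative root. The `f_α` part cancels because
-- a positive root minus a different simple root is positive if it is a root at all. For `β = α` the
-- bracket lies in `H`, where `r` vanishes, so only the first term of `coad` survives.
open scoped Classical in
theorem coad_pos_ef {α β : H.root} (hα : α ∈ D.base.support) (hβ : D.base.IsPos β) {y : L}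
    (hy : y ∈ rootSpace H (β : Weight K H L)) :
    D.coad y (D.e α + D.f α) = if α = β then (1 / 2 : K) • ⁅D.f α, y⁆ else 0 := by
  have hαp := RootPairing.Base.isPos_of_mem_support hα
  have hry : D.rOp y = (1 / 2 : K) • y :=
    D.rOp_of_pos (root_coe_ne_zero β) (fun γ hγ => by rwa [(root_eq_iff γ β).1 hγ]) hy
  have he : D.coad y (D.e α) = 0 := by
    apply D.coad_eq_zero hry
    exact D.rOp_of_pos (D.root_add_ne_zero hαp hβ)
      (fun γ hγ => hαp.add hβ (root_eq_add hγ)) (lie_mem_rootSpace (D.e_mem α hαp) hy rfl)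
  rw [map_add, he, zero_add]
  split_ifs with h
  · subst h
    rw [coad_apply, hry, D.rOp_of_mem_cartan, sub_zero, lie_smul]
    exact mem_of_mem_rootSpace_zero (lie_mem_rootSpace (D.f_mem α hαp) hy (by simp))
  · apply D.coad_eq_zero hry
    have hne : ((β : Weight K H L) : H → K) - (α : Weight K H L) ≠ 0 := by
      rw [sub_ne_zero, Ne, root_eq_iff]
      exact fun h' => h h'.symm
    exact D.rOp_of_pos hne (fun γ hγ => hβ.sub hα (root_eq_sub hγ))
      (lie_mem_rootSpace (D.f_mem α hαp) hy (by rw [sub_eq_add_neg, add_comm]))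

open scoped Classical in
theorem coad_neg_ef {α β : H.root} (hα : α ∈ D.base.support) (hβ : D.base.IsPos β) {y : L}
    (hy : y ∈ rootSpace H (-(β : Weight K H L) : H → K)) :
    D.coad y (D.e α + D.f α) = if α = β then -((1 / 2 : K) • ⁅D.e α, y⁆) else 0 := by
  have hαp := RootPairing.Base.isPos_of_mem_support hα
  have hry : D.rOp y = (-(1 / 2) : K) • y := by
    rw [neg_smul]
    exact D.rOp_of_neg (root_coe_ne_zero β) (fun γ hγ => by rwa [(root_eq_iff γ β).1 hγ]) hy
  have hf : D.coad y (D.f α) = 0 := by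
    apply D.coad_eq_zero hry
    rw [neg_smul]
    exact D.rOp_of_neg (D.root_add_ne_zero hαp hβ)
      (fun γ hγ => hαp.add hβ (root_eq_add hγ))
      (lie_mem_rootSpace (D.f_mem α hαp) hy (by rw [neg_add]))
  rw [map_add, hf, add_zero]
  split_ifs with h
  · subst h
    rw [coad_apply, hry, D.rOp_of_mem_cartan, sub_zero, lie_smul, neg_smul]
    exact mem_of_mem_rootSpace_zero (lie_mem_rootSpace (D.e_mem α hαp) hy (by simp))
  · apply D.coad_eq_zero hry
    have hne : ((β : Weight K H L) : H → K) - (α : Weight K H L) ≠ 0 := by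
      rw [sub_ne_zero, Ne, root_eq_iff]
      exact fun h' => h h'.symm
    rw [neg_smul]
    exact D.rOp_of_neg hne (fun γ hγ => hβ.sub hα (root_eq_sub hγ))
      (lie_mem_rootSpace (D.e_mem α hαp) hy (by rw [neg_sub, sub_eq_add_neg]))

/-- By linearity `y` may be taken in `H` or in a root space. On the `h_i` the action is zero: `H` is
abelian, and `ad h_i` preserves each root space, on which `r` is scalar. On `e_α + f_α` the result
is a multiple of the same vector or an element of `H`. -/
theorem coad_mem_todaSpan (y : L) {v : L} (hv : v ∈ D.todaSpan) : D.coad y v ∈ D.todaSpan := by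
  suffices h : ∀ y, ∀ v ∈ D.todaSpan, D.coad y v ∈ D.todaSpan from h y v hv
  clear hv y v
  intro y
  have htop := D.eq_top_of_rootSpace_le
    (S := ({ carrier := {y | ∀ v ∈ D.todaSpan, D.coad y v ∈ D.todaSpan}
             add_mem' := fun {a b} ha hb v hv => by
               rw [map_add]; exact add_mem (ha v hv) (hb v hv)
             zero_mem' := fun v hv => by rw [map_zero]; exact zero_mem _
             smul_mem' := fun c x hx v hv => by
               rw [map_smul]; exact Submodule.smul_mem _ _ (hx v hv) } : Submodule K L))
    ?_ ?_ ?_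
  · have : y ∈ (⊤ : Submodule K L) := trivial
    rw [← htop] at this
    exact this
  · intro y hy v hv
    induction hv using Submodule.span_induction with
    | zero => rw [map_zero]; exact zero_mem _
    | add a b _ _ ha hb => rw [map_add]; exact add_mem ha hb
    | smul c a _ ha => rw [map_smul]; exact Submodule.smul_mem _ _ ha
    | mem v hv =>
      rcases hv with ⟨i, rfl⟩ | ⟨α, hα, rfl⟩
      · rw [coad_apply, D.rOp_of_mem_cartan hy, lie_eq_zero_of_mem_cartan (D.h i).2 hy]
        simp
      · rw [D.coad_cartan_ef (RootPairing.Base.isPos_of_mem_support hα) ⟨y, hy⟩]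
        exact Submodule.smul_mem _ _ (D.ef_mem_todaSpan hα)
  · intro β hβ y hy v hv
    induction hv using Submodule.span_induction with
    | zero => rw [map_zero]; exact zero_mem _
    | add a b _ _ ha hb => rw [map_add]; exact add_mem ha hb
    | smul c a _ ha => rw [map_smul]; exact Submodule.smul_mem _ _ ha
    | mem v hv =>
      rcases hv with ⟨i, rfl⟩ | ⟨α, hα, rfl⟩
      · have hr : ∀ z ∈ rootSpace H (β : Weight K H L), D.rOp z = (1 / 2 : K) • z :=
          fun z hz => D.rOp_of_pos (root_coe_ne_zero β)
            (fun γ hγ => by rwa [(root_eq_iff γ β).1 hγ]) hz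
        rw [D.coad_eq_zero (hr y hy)
          (hr _ (lie_mem_rootSpace (mem_rootSpace_zero (D.h i).2) hy (by rw [zero_add])))]
        exact zero_mem _
      · rw [D.coad_pos_ef hα hβ hy]
        split_ifs with h
        · subst h
          refine Submodule.smul_mem _ _ (D.cartan_mem_todaSpan ?_)
          exact mem_of_mem_rootSpace_zero (lie_mem_rootSpace (D.f_mem α hβ) hy (by simp))
        · exact zero_mem _
  · intro β hβ y hy v hv
    induction hv using Submodule.span_induction with
    | zero => rw [map_zero]; exact zero_mem _
    | add a b _ _ ha hb => rw [map_add]; exact add_mem ha hb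
    | smul c a _ ha => rw [map_smul]; exact Submodule.smul_mem _ _ ha
    | mem v hv =>
      rcases hv with ⟨i, rfl⟩ | ⟨α, hα, rfl⟩
      · have hr : ∀ z ∈ rootSpace H (-(β : Weight K H L) : H → K), D.rOp z = (-(1 / 2) : K) • z :=
          fun z hz => by
            rw [neg_smul]
            exact D.rOp_of_neg (root_coe_ne_zero β)
              (fun γ hγ => by rwa [(root_eq_iff γ β).1 hγ]) hz
        rw [D.coad_eq_zero (hr y hy)
          (hr _ (lie_mem_rootSpace (mem_rootSpace_zero (D.h i).2) hy (by rw [zero_add])))]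
        exact zero_mem _
      · rw [D.coad_neg_ef hα hβ hy]
        split_ifs with h
        · subst h
          refine neg_mem (Submodule.smul_mem _ _ (D.cartan_mem_todaSpan ?_))
          exact mem_of_mem_rootSpace_zero (lie_mem_rootSpace (D.e_mem α hβ) hy (by simp))
        · exact zero_mem _

theorem exists_coad_sum_eq_ef {α : H.root} (hα : α ∈ D.base.support) :
    ∃ y, D.coad y (∑ β ∈ D.base.support, (D.e β + D.f β)) = D.e α + D.f α := by
  classical
  let b := D.base.toWeightBasis
  -- The fundamental coweight of `α`: it takes the value `1` on `α` and `0` on the other simple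
  -- roots. The witness `2 t` cancels the factor `½` in `coad_cartan_ef`.
  let t : H := (Module.evalEquiv K H).symm (b.coord ⟨α, hα⟩)
  have ht : ∀ β ∈ D.base.support, (β : Weight K H L) t = if α = β then 1 else 0 := by
    intro β hβ
    have h1 : b ⟨β, hβ⟩ t = b.coord ⟨α, hα⟩ (b ⟨β, hβ⟩) :=
      Module.apply_evalEquiv_symm_apply K H (b ⟨β, hβ⟩) (b.coord ⟨α, hα⟩)
    have h2 : b ⟨β, hβ⟩ = (rootSystem H).root β := D.base.toWeightBasis_apply _
    rw [Module.Basis.coord_apply, Module.Basis.repr_self, Finsupp.single_apply, h2] at h1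
    simpa [eq_comm] using h1
  refine ⟨(2 : K) • (t : L), ?_⟩
  rw [map_smul, LinearMap.smul_apply, map_sum, Finset.sum_eq_single α]
  · rw [D.coad_cartan_ef (RootPairing.Base.isPos_of_mem_support hα), ht α hα]
    simp
  · intro β hβ hne
    rw [D.coad_cartan_ef (RootPairing.Base.isPos_of_mem_support hβ), ht β hβ, if_neg hne.symm]
    simp
  · exact fun h => absurd hα h

theorem repr_h_eq_traceForm (x : H) (i : Fin s) :
    D.h.repr x i = traceForm K L W (x : L) (D.h i : L) := by
  conv_rhs => rw [← D.h.sum_repr x]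
  rw [AddSubmonoidClass.coe_finsetSum, map_sum, LinearMap.sum_apply, Finset.sum_eq_single i]
  · simp [D.h_orthonormal]
  · intro j _ hj
    simp [D.h_orthonormal, hj]
  · simp

theorem eq_zero_of_traceForm_cartan (D : TodaData K L H W s) {x : L} (hx : x ∈ H)
    (h : ∀ t : H, traceForm K L W x (t : L) = 0) : x = 0 := by
  have h1 : (⟨x, hx⟩ : H) = 0 := by
    apply D.h.repr.injective
    ext i
    rw [repr_h_eq_traceForm, h, map_zero]
    rfl
  exact congrArg Subtype.val h1

theorem lie_e_f_mem {α : H.root} (hα : D.base.IsPos α) : ⁅D.e α, D.f α⁆ ∈ H :=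
  mem_of_mem_rootSpace_zero (lie_mem_rootSpace (D.e_mem α hα) (D.f_mem α hα) (by simp))

/-- By invariance and `tr(e_α f_α) = 1`, the element `[e_α, f_α]` of `H` represents the root `α`
through the trace form. -/
theorem traceForm_lie_e_f {α : H.root} (hα : D.base.IsPos α) (t : H) :
    traceForm K L W ⁅D.e α, D.f α⁆ (t : L) = (α : Weight K H L) t := by
  have hf : ⁅(t : L), D.f α⁆ = (-(α : Weight K H L) t) • D.f α :=
    lie_eq_smul_of_mem_rootSpace (D.f_mem α hα) t
  rw [traceForm_apply_lie_apply, ← lie_skew, hf, neg_smul, neg_neg, map_smul, D.trace_e_f α hα]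
  simp

theorem coad_e_sum {α : H.root} (hα : α ∈ D.base.support) :
    D.coad (D.e α) (∑ β ∈ D.base.support, (D.e β + D.f β)) =
      (1 / 2 : K) • ⁅D.f α, D.e α⁆ := by
  have hαp := RootPairing.Base.isPos_of_mem_support hα
  rw [map_sum, Finset.sum_eq_single α]
  · rw [D.coad_pos_ef hα hαp (D.e_mem α hαp), if_pos rfl]
  · intro β hβ hne
    rw [D.coad_pos_ef hβ hαp (D.e_mem α hαp), if_neg hne]
  · exact fun h => absurd hα h

theorem exists_coad_sum_eq_cartan {t : L} (ht : t ∈ H) :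
    ∃ y, D.coad y (∑ β ∈ D.base.support, (D.e β + D.f β)) = t := by
  let b := D.base.toWeightBasis
  let φ : Module.Dual K H := traceForm K L W t ∘ₗ H.toSubmodule.subtype
  have hp (β : D.base.support) : D.base.IsPos (β : H.root) :=
    RootPairing.Base.isPos_of_mem_support β.2
  -- Expand the functional `tr(t ·)` on `H` in the basis of simple roots. The `[e_β, f_β]` represent
  -- these roots and the form on `H` is nondegenerate, so `t` has the same coefficients.
  have hu : t = ∑ β : D.base.support, b.repr φ β • ⁅D.e β, D.f β⁆ := by
    rw [← sub_eq_zero]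
    apply D.eq_zero_of_traceForm_cartan
    · exact H.sub_mem ht (H.toSubmodule.sum_mem fun β _ => H.smul_mem _ (D.lie_e_f_mem (hp β)))
    · intro x
      have h1 := LinearMap.congr_fun (b.sum_repr φ) x
      have h2 : ∀ β, b β = (rootSystem H).root β := D.base.toWeightBasis_apply
      simp only [LinearMap.sum_apply, LinearMap.smul_apply, h2] at h1
      have h3 : φ x = traceForm K L W t (x : L) := rfl
      rw [map_sub, LinearMap.sub_apply, ← h3, ← h1, sub_eq_zero, map_sum, LinearMap.sum_apply]
      refine Finset.sum_congr rfl fun β _ => ?_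
      rw [map_smul, LinearMap.smul_apply, D.traceForm_lie_e_f (hp β)]
      rfl
  -- The factor `-2` undoes `coad e_β x' = ½ [f_β, e_β] = -½ [e_β, f_β]`.
  refine ⟨∑ β : D.base.support, b.repr φ β • (-2 : K) • D.e β, ?_⟩
  rw [map_sum D.coad, LinearMap.sum_apply]
  conv_rhs => rw [hu]
  refine Finset.sum_congr rfl fun β _ => ?_
  rw [map_smul, map_smul, LinearMap.smul_apply, LinearMap.smul_apply, D.coad_e_sum β.2,
    ← lie_skew (D.e β)]
  module

theorem exists_coad_sum_eq {v : L} (hv : v ∈ D.todaSpan) :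
    ∃ y, D.coad y (∑ β ∈ D.base.support, (D.e β + D.f β)) = v := by
  have h : D.todaSpan ≤
      LinearMap.range (D.coad.flip (∑ β ∈ D.base.support, (D.e β + D.f β))) := by
    rw [todaSpan, Submodule.span_le]
    rintro _ (⟨i, rfl⟩ | ⟨α, hα, rfl⟩)
    · exact D.exists_coad_sum_eq_cartan (D.h i).2
    · exact D.exists_coad_sum_eq_ef hα
  exact h hv

end FiniteCoadjoint

end TodaData

/-! ### Homogeneous elements of the Takiff algebra -/

section TakiffElements

variable {K L : Type*} [Field K] [LieRing L] [LieAlgebra K L] (N : ℕ)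

/-- `el` as a linear map. -/
def elₗ (k : ℕ) : L →ₗ[K] Takiff K L N :=
  TensorProduct.mk K (Trunc K N) L (AdjoinRoot.root ((Polynomial.X : Polynomial K) ^ (N + 1)) ^ k)

theorem elₗ_apply (k : ℕ) (x : L) : elₗ (K := K) N k x = el N k x := rfl

/-- Degrees above `N` are allowed and give zero, so that brackets of homogeneous elements can be
written in degree `i + j` without a case distinction. -/
theorem el_eq_zero {k : ℕ} (hk : N < k) (x : L) : (el N k x : Takiff K L N) = 0 := by
  rw [el, root_pow_eq_zero N k hk, TensorProduct.zero_tmul]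

theorem lie_el_el (i j : ℕ) (x y : L) :
    ⁅(el N i x : Takiff K L N), (el N j y : Takiff K L N)⁆ = el N (i + j) ⁅x, y⁆ := by
  simp only [el, LieAlgebra.ExtendScalars.bracket_tmul, pow_add]

variable {N} in
theorem el_induction {p : Takiff K L N → Prop} (zero : p 0) (add : ∀ a b, p a → p b → p (a + b))
    (el : ∀ k x, p (el N k x)) (z : Takiff K L N) : p z := by
  obtain ⟨c, rfl⟩ := exists_eq_sum_el N z
  exact Finset.sum_induction _ p add zero fun i _ => el i (c i)

theorem form_comm (W : Type*) [AddCommGroup W] [Module K W] [LieRingModule L W] [LieModule K L W]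
    (x y : Takiff K L N) : form K L N W x y = form K L N W y x := by
  induction x using el_induction with
  | zero => simp
  | add a b ha hb => rw [map_add, LinearMap.add_apply, map_add, ha, hb]
  | el i x =>
    induction y using el_induction with
    | zero => simp
    | add a b ha hb => rw [map_add, map_add, LinearMap.add_apply, ha, hb]
    | el j y => rw [form_el_el, form_el_el, add_comm j i, LieModule.traceForm_comm]

end TakiffElements

namespace TodaData

/-! ### The coadjoint action on `𝔤_N`, the basis of `V` and the projection -/

section TakiffCoadjoint

set_option linter.unusedSectionVars false

variable {K : Type*} [RCLike K] {L : Type*} [LieRing L] [LieAlgebra K L]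
  [FiniteDimensional K L] [LieAlgebra.IsSimple K L] {H : LieSubalgebra K L}
  [H.IsCartanSubalgebra] [LieModule.IsTriangularizable K H L]
  {W : Type*} [AddCommGroup W] [Module K W] [LieRingModule L W] [LieModule K L W] {s : ℕ}
  (D : TodaData K L H W s) (N : ℕ)

theorem R_el (k : ℕ) (x : L) : D.R N (el N k x) = el N k (D.rOp x) := by
  rcases lt_or_ge N k with hk | hk
  · rw [el_eq_zero N hk, el_eq_zero N hk, map_zero]
  · rw [← elₗ_apply (K := K) N k (D.rOp x), rOp_apply, map_smul, map_sum]
    simp only [R, LinearMap.smul_apply, LinearMap.sum_apply, LinearMap.sub_apply,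
      LinearMap.smulRight_apply, form_el_el, map_sub, map_smul, elₗ_apply]
    congr 1
    refine Finset.sum_congr rfl fun α _ => ?_
    -- A pairing with `x(k)` survives only in degree `N - k`: this is `i = k` for `f_α(N - i)` and
    -- `i = N - k` for `e_α(i)`.
    rw [Finset.sum_sub_distrib, Finset.sum_eq_single k, Finset.sum_eq_single (N - k)]
    · rw [if_pos (by omega), if_pos (by omega), Nat.sub_sub_self hk]
    · intro i hi hne
      rw [Finset.mem_range] at hi
      rw [if_neg (by omega), zero_smul]
    · intro h
      exact absurd (Finset.mem_range.2 (by omega)) h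
    · intro i hi hne
      rw [Finset.mem_range] at hi
      rw [if_neg (by omega), zero_smul]
    · intro h
      exact absurd (Finset.mem_range.2 (by omega)) h

theorem bracketR_apply (x y : Takiff K L N) :
    D.bracketR N x y = ⁅D.R N x, y⁆ + ⁅x, D.R N y⁆ := rfl

theorem bracketR_el_el (i j : ℕ) (x y : L) : D.bracketR N (el N i x) (el N j y) =
    el N (i + j) (⁅D.rOp x, y⁆ + ⁅x, D.rOp y⁆) := by
  rw [bracketR_apply, R_el, R_el, lie_el_el, lie_el_el, ← elₗ_apply N (i + j) (_ + _), map_add]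
  rfl

/-- The infinitesimal coadjoint action of `𝔤_N^R`, transported to `𝔤_N` by the form. -/
def coadR : Takiff K L N →ₗ[K] Takiff K L N →ₗ[K] Takiff K L N :=
  LinearMap.mk₂ K (fun y v => ⁅v, D.R N y⁆ - D.R N ⁅v, y⁆)
    (fun y y' v => by simp only [map_add, lie_add]; abel)
    (fun c y v => by simp only [map_smul, lie_smul, smul_sub])
    (fun y v v' => by simp only [map_add, add_lie]; abel)
    (fun c y v => by simp only [map_smul, smul_lie, smul_sub])

theorem coadR_el_el (i j : ℕ) (y v : L) :
    D.coadR N (el N i y) (el N j v) = el N (i + j) (D.coad y v) := by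
  have h : D.coadR N (el N i y) (el N j v) =
    ⁅el N j v, D.R N (el N i y)⁆ - D.R N ⁅el N j v, el N i y⁆ := rfl
  rw [h, R_el, lie_el_el, lie_el_el, R_el, coad_apply, ← elₗ_apply N (i + j) (_ - _), map_sub,
    add_comm i j]
  rfl

theorem form_bracketR (y z v : Takiff K L N) :
    form K L N W (D.bracketR N y z) v = form K L N W z (D.coadR N y v) := by
  induction y using el_induction with
  | zero => simp
  | add a b ha hb => simp only [map_add, LinearMap.add_apply, ha, hb]
  | el i y =>
    induction z using el_induction with
    | zero => simp
    | add a b ha hb => simp only [map_add, LinearMap.add_apply, ha, hb]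
    | el j z =>
      induction v using el_induction with
      | zero => simp
      | add a b ha hb => simp only [map_add, ha, hb]
      | el k v =>
        rw [bracketR_el_el, coadR_el_el, form_el_el, form_el_el, traceForm_coad]
        congr 1
        exact propext ⟨fun h => by omega, fun h => by omega⟩

theorem el_mem_V (k : ℕ) {v : L} (hv : v ∈ D.todaSpan) : el N k v ∈ D.V N := by
  rcases lt_or_ge N k with hk | hk
  · rw [el_eq_zero N hk]; exact zero_mem _
  · have h : D.todaSpan ≤ (D.V N).comap (elₗ N k) := by
      rw [todaSpan, Submodule.span_le]
      rintro _ (⟨i, rfl⟩ | ⟨α, hα, rfl⟩)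
      · exact D.h_mem_V N i k hk
      · change elₗ N k _ ∈ D.V N
        rw [map_add]
        exact D.ef_mem_V N α hα k hk
    exact h hv

theorem V_le {S : Submodule K (Takiff K L N)} (h : ∀ k, ∀ v ∈ D.todaSpan, el N k v ∈ S) :
    D.V N ≤ S := by
  rw [V, Submodule.span_le]
  rintro _ (⟨i, k, hk, rfl⟩ | ⟨α, hα, k, hk, rfl⟩)
  · exact h k _ (D.cartan_mem_todaSpan (D.h i).2)
  · have := h k _ (D.ef_mem_todaSpan hα)
    rw [← elₗ_apply, map_add] at this
    exact this

theorem coadR_mem_V (y : Takiff K L N) {v : Takiff K L N} (hv : v ∈ D.V N) :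
    D.coadR N y v ∈ D.V N := by
  induction y using el_induction with
  | zero => simp
  | add a b ha hb => rw [map_add]; exact add_mem ha hb
  | el i y =>
    refine D.V_le N (S := (D.V N).comap (D.coadR N (el N i y))) (fun k v hv => ?_) hv
    rw [Submodule.mem_comap, coadR_el_el]
    exact D.el_mem_V N _ (D.coad_mem_todaSpan y hv)

theorem x'_eq : D.x' N = el N 0 (∑ β ∈ D.base.support, (D.e β + D.f β)) := by
  rw [← elₗ_apply, map_sum]
  simp only [map_add]
  rfl

theorem x'_mem_V : D.x' N ∈ D.V N := by
  rw [x'_eq]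
  exact D.el_mem_V N 0 (Submodule.sum_mem _ fun β hβ => D.ef_mem_todaSpan hβ)

/-- As `x'` has degree `0`, acting by `y(k)` gives the finite-dimensional answer for `y` placed in
degree `k`; every degree of `V` is reached. -/
theorem exists_coadR_x'_eq {v : Takiff K L N} (hv : v ∈ D.V N) :
    ∃ y, D.coadR N y (D.x' N) = v := by
  refine D.V_le N (S := LinearMap.range ((D.coadR N).flip (D.x' N))) (fun k v hv => ?_) hv
  obtain ⟨y, rfl⟩ := D.exists_coad_sum_eq hv
  refine ⟨el N k y, ?_⟩
  rw [LinearMap.flip_apply, x'_eq, coadR_el_el]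
  rfl

theorem traceForm_h_e (i : Fin s) {α : H.root} (hα : D.base.IsPos α) :
    LieModule.traceForm K L W (D.h i) (D.e α) = 0 :=
  traceForm_eq_zero_of_mem_rootSpace W (mem_rootSpace_zero (D.h i).2) (D.e_mem α hα)
    (by rw [zero_add]; exact root_coe_ne_zero α)

theorem traceForm_h_f (i : Fin s) {α : H.root} (hα : D.base.IsPos α) :
    LieModule.traceForm K L W (D.h i) (D.f α) = 0 :=
  traceForm_eq_zero_of_mem_rootSpace W (mem_rootSpace_zero (D.h i).2) (D.f_mem α hα)
    (by rw [zero_add, neg_ne_zero]; exact root_coe_ne_zero α)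

/-- The elements `h_i`, `e_α + f_α` (for simple `α`) of `𝔤`. -/
def todaVec : Fin s ⊕ D.base.support → L :=
  Sum.elim (fun i => (D.h i : L)) (fun α => D.e α + D.f α)

/-- The squared lengths of the elements `h_i`, `e_α + f_α`. -/
def todaNorm : Fin s ⊕ D.base.support → K := Sum.elim (fun _ => 1) (fun _ => 2)

theorem todaNorm_ne_zero (a : Fin s ⊕ D.base.support) : D.todaNorm a ≠ 0 := by
  rcases a with i | α <;> simp [todaNorm]

-- The squared length `2` of `e_α + f_α` is `tr(ef) + tr(fe)`, and accounts for the factor `½` in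
-- `projV`.
open scoped Classical in
theorem traceForm_todaVec (a b : Fin s ⊕ D.base.support) :
    LieModule.traceForm K L W (D.todaVec a) (D.todaVec b) = if a = b then D.todaNorm a else 0 := by
  have hp (β : D.base.support) : D.base.IsPos (β : H.root) :=
    RootPairing.Base.isPos_of_mem_support β.2
  rcases a with i | α <;> rcases b with j | β
  · simp [todaVec, todaNorm, D.h_orthonormal]
  · simp [todaVec, D.traceForm_h_e i (hp β), D.traceForm_h_f i (hp β)]
  · rw [LieModule.traceForm_comm]
    simp [todaVec, D.traceForm_h_e j (hp α), D.traceForm_h_f j (hp α)]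
  · simp only [todaVec, todaNorm, Sum.elim_inr, map_add, LinearMap.add_apply,
      D.traceForm_e_e (hp α) (hp β), D.traceForm_f_f (hp α) (hp β),
      LieModule.traceForm_comm K L W (D.f α), Sum.inr.injEq]
    split_ifs with h
    · subst h
      rw [D.trace_e_f _ (hp α)]
      norm_num
    · have h' : (α : H.root) ≠ β := fun h' => h (Subtype.ext h')
      rw [D.traceForm_e_f (hp α) (hp β) h', D.traceForm_e_f (hp β) (hp α) h'.symm]
      simp

/-- The basis of `V`. -/
def takiffVec (p : Fin (N + 1) × (Fin s ⊕ D.base.support)) : Takiff K L N :=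
  el N p.1 (D.todaVec p.2)

theorem span_range_takiffVec : Submodule.span K (Set.range (D.takiffVec N)) = D.V N := by
  apply le_antisymm
  · rw [Submodule.span_le]
    rintro _ ⟨⟨k, i | α⟩, rfl⟩
    · exact D.el_mem_V N k (D.cartan_mem_todaSpan (D.h i).2)
    · exact D.el_mem_V N k (D.ef_mem_todaSpan α.2)
  · rw [V, Submodule.span_le]
    rintro _ (⟨i, k, hk, rfl⟩ | ⟨α, hα, k, hk, rfl⟩)
    · exact Submodule.subset_span ⟨(⟨k, Nat.lt_succ_of_le hk⟩, Sum.inl i), rfl⟩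
    · refine Submodule.subset_span ⟨(⟨k, Nat.lt_succ_of_le hk⟩, Sum.inr ⟨α, hα⟩), ?_⟩
      exact map_add (elₗ (K := K) N k) (D.e α) (D.f α)

-- Up to the squared lengths, the same vectors in the complementary degree form the dual basis.
-- Linear independence and the projection formula both follow from this.
open scoped Classical in
theorem form_takiffVec (j : Fin (N + 1)) (p : Fin (N + 1) × (Fin s ⊕ D.base.support))
    (b : Fin s ⊕ D.base.support) : form K L N W (el N (N - (j : ℕ)) (D.todaVec b))
      (D.takiffVec N p) = if p = (j, b) then D.todaNorm b else 0 := by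
  obtain ⟨k, a⟩ := p
  rw [takiffVec, form_el_el, traceForm_todaVec]
  have hj := j.2
  have hk := k.2
  by_cases h1 : k = j
  · subst h1
    rw [if_pos (by simp only; omega)]
    by_cases h2 : b = a
    · subst h2; simp
    · simp [h2, Ne.symm h2]
  · rw [if_neg (by
      intro h
      apply h1
      ext
      simp only at h
      omega), if_neg (fun h => h1 (congrArg Prod.fst h))]

theorem linearIndependent_takiffVec : LinearIndependent K (D.takiffVec N) := by
  classical
  rw [Fintype.linearIndependent_iff]
  rintro c hc ⟨j, b⟩
  have h := congrArg (form K L N W (el N (N - (j : ℕ)) (D.todaVec b))) hc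
  simp only [map_sum, map_smul, form_takiffVec, map_zero, smul_eq_mul] at h
  rw [Finset.sum_eq_single (j, b) (fun p _ hp => by rw [if_neg hp, mul_zero]) (by simp),
    if_pos rfl] at h
  exact (mul_eq_zero.1 h).resolve_right (D.todaNorm_ne_zero b)

/-- The simple roots form a basis of the dual of `H`, and the `h_i` form a basis of `H`. -/
theorem card_support : D.base.support.card = s := by
  have h1 := Module.finrank_eq_card_basis D.base.toWeightBasis
  have h2 := Module.finrank_eq_card_basis D.h
  rw [Subspace.dual_finrank_eq, h2] at h1
  simpa using h1.symm

theorem finrank_V : Module.finrank K (D.V N) = 2 * s * (N + 1) := by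
  rw [← span_range_takiffVec, finrank_span_eq_card (D.linearIndependent_takiffVec N)]
  simp only [Fintype.card_prod, Fintype.card_fin, Fintype.card_sum, Fintype.card_coe, card_support]
  ring

/-- The vectors `h_i(k)`, `e_α(k) + f_α(k)` as a basis of `V`. -/
def basisV : Module.Basis (Fin (N + 1) × (Fin s ⊕ D.base.support)) K (D.V N) :=
  (Module.Basis.span (D.linearIndependent_takiffVec N)).map
    (LinearEquiv.ofEq _ _ (D.span_range_takiffVec N))

theorem projV_eq_sum (z : Takiff K L N) : (D.projV N z : Takiff K L N) =
    ∑ p, ((D.todaNorm p.2)⁻¹ * form K L N W (el N (N - (p.1 : ℕ)) (D.todaVec p.2)) z) •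
      D.takiffVec N p := by
  rw [Fintype.sum_prod_type]
  simp only [projV, LinearMap.sum_apply, AddSubmonoidClass.coe_finsetSum, Fintype.sum_sum_type]
  refine Finset.sum_congr rfl fun k _ => ?_
  have h2 (α : D.base.support) (m : ℕ) :
      (el N m (D.e α + D.f α) : Takiff K L N) = el N m (D.e α) + el N m (D.f α) :=
    map_add (elₗ (K := K) N m) _ _
  simp only [LinearMap.add_apply, LinearMap.smul_apply, LinearMap.sum_apply,
    LinearMap.smulRight_apply, Submodule.coe_add, Submodule.coe_smul,
    AddSubmonoidClass.coe_finsetSum, Finset.smul_sum, takiffVec, todaVec, todaNorm, Sum.elim_inl,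
    Sum.elim_inr, inv_one, one_mul, one_div, smul_smul, h2]

theorem form_projV (z : Takiff K L N) (v : D.V N) :
    form K L N W (D.projV N z) v = form K L N W z v := by
  classical
  suffices h : ∀ p, form K L N W (D.projV N z) (D.takiffVec N p) =
      form K L N W z (D.takiffVec N p) by
    have hle : D.V N ≤ LinearMap.ker (form K L N W (D.projV N z) - form K L N W z) := by
      refine (D.span_range_takiffVec N).ge.trans (Submodule.span_le.2 ?_)
      rintro _ ⟨p, rfl⟩
      simp [h]
    have := hle v.2
    rwa [LinearMap.mem_ker, LinearMap.sub_apply, sub_eq_zero] at this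
  rintro ⟨j, b⟩
  have hj := j.2
  -- In degree `j` the basis vector is itself the dual vector for index `j' = N - j`, so that
  -- pairing with it picks out one summand of the projection.
  let j' : Fin (N + 1) := ⟨N - j, by omega⟩
  have hv : D.takiffVec N (j, b) = el N (N - (j' : ℕ)) (D.todaVec b) := by
    rw [takiffVec]
    congr 1
    simp only [j']
    omega
  rw [hv, projV_eq_sum, form_comm N W _ (el N _ _), form_comm N W z, map_sum,
    Finset.sum_eq_single (j', b) (fun p _ hp => by
      rw [map_smul, form_takiffVec, if_neg hp, smul_zero]) (by simp), map_smul, form_takiffVec,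
    if_pos rfl, smul_eq_mul]
  field_simp [D.todaNorm_ne_zero b]

end TakiffCoadjoint

end TodaData

namespace TodaData

/-! ### Invariance of `V` and openness of the orbit -/

section Orbit

set_option linter.unusedSectionVars false

variable {K : Type*} [RCLike K] {L : Type*} [LieRing L] [LieAlgebra K L]
  [FiniteDimensional K L] [LieAlgebra.IsSimple K L] {H : LieSubalgebra K L}
  [H.IsCartanSubalgebra] [LieModule.IsTriangularizable K H L]
  {W : Type*} [AddCommGroup W] [Module K W] [LieRingModule L W] [LieModule K L W] {s : ℕ}
  {D : TodaData K L H W s} {N : ℕ}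

theorem eq_of_form_eq (D : TodaData K L H W s) {w w' : Takiff K L N}
    (h : ∀ z, form K L N W w z = form K L N W w' z) : w = w' :=
  D.form_injective N (LinearMap.ext h)

theorem form_sub_projV (z : Takiff K L N) {v : Takiff K L N} (hv : v ∈ D.V N) :
    form K L N W (z - D.projV N z) v = 0 := by
  rw [map_sub, LinearMap.sub_apply, D.form_projV N z ⟨v, hv⟩, sub_self]

/-- This is `V^⊥⊥ ⊆ V`. Since `z - proj z` is orthogonal to `V`, the vector `w` pairs with `z` as it
does with `proj z`, and the projection is self-adjoint, so `w = proj w`. -/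
theorem mem_V_of_forall_form_eq_zero {w : Takiff K L N}
    (hw : ∀ z, (∀ v ∈ D.V N, form K L N W z v = 0) → form K L N W w z = 0) : w ∈ D.V N := by
  have h : w = D.projV N w := by
    refine eq_of_form_eq D fun z => ?_
    have h1 := hw (z - D.projV N z) (fun v hv => form_sub_projV z hv)
    rw [map_sub, sub_eq_zero] at h1
    calc form K L N W w z = form K L N W w (D.projV N z) := h1
      _ = form K L N W (D.projV N w) (D.projV N z) := (D.form_projV N w (D.projV N z)).symm
      _ = form K L N W (D.projV N z) (D.projV N w) := form_comm N W _ _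
      _ = form K L N W z (D.projV N w) := D.form_projV N z (D.projV N w)
      _ = form K L N W (D.projV N w) z := form_comm N W _ _
  rw [h]
  exact (D.projV N w).2

theorem projV_eq_of_form_eq {z : Takiff K L N} {w : D.V N}
    (h : ∀ v ∈ D.V N, form K L N W z v = form K L N W w v) : D.projV N z = w := by
  apply Subtype.ext
  refine eq_of_form_eq D fun x => ?_
  have h1 := form_sub_projV x (D.projV N z).2
  have h2 := form_sub_projV x w.2
  rw [map_sub, LinearMap.sub_apply, sub_eq_zero] at h1 h2
  calc form K L N W (D.projV N z) x = form K L N W x (D.projV N z) := form_comm N W _ _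
    _ = form K L N W (D.projV N x) (D.projV N z) := h1
    _ = form K L N W (D.projV N z) (D.projV N x) := form_comm N W _ _
    _ = form K L N W z (D.projV N x) := D.form_projV N z (D.projV N x)
    _ = form K L N W w (D.projV N x) := h _ (D.projV N x).2
    _ = form K L N W (D.projV N x) w := form_comm N W _ _
    _ = form K L N W x w := h2.symm
    _ = form K L N W w x := form_comm N W _ _

theorem projV_of_mem (v : D.V N) : D.projV N v = v := projV_eq_of_form_eq (D := D) fun _ _ => rfl

variable {E : Type*} [NormedAddCommGroup E] [NormedSpace K E]
  {G : Type*} [TopologicalSpace G] [ChartedSpace E G] [Group G]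

theorem form_coadjoint (φ : D.LieAlgIdent N E G) (g : G) (x z : Takiff K L N) :
    form K L N W (coadjoint φ g x) z =
      form K L N W x (φ.toEquiv (Ad K E g⁻¹ (φ.toEquiv.symm z))) := by
  rw [← D.ν_apply, ← D.ν_apply, coadjoint]
  simp only [LinearMap.comp_apply, LinearEquiv.coe_coe, LinearEquiv.apply_symm_apply]
  rfl

theorem coadjoint_mul [LieGroup 𝓘(K, E) 1 G] (φ : D.LieAlgIdent N E G) (g h : G)
    (x : Takiff K L N) : coadjoint φ (g * h) x = coadjoint φ g (coadjoint φ h x) := by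
  refine eq_of_form_eq D fun z => ?_
  rw [form_coadjoint, form_coadjoint, form_coadjoint, mul_inv_rev, Ad_mul]
  simp

theorem coadjoint_one [LieGroup 𝓘(K, E) 1 G] (φ : D.LieAlgIdent N E G)
    (x : Takiff K L N) : coadjoint φ 1 x = x := by
  refine eq_of_form_eq D fun z => ?_
  rw [form_coadjoint, inv_one, Ad_one]
  simp

/-- The subspace `P = V^⊥` is an ideal for `[·,·]_R`, because `V` is stable under the transposed
action `coadR`. Hence `Ad` preserves `P`, and the dual action preserves `P^⊥ = V`. -/
theorem coadjoint_mem_V [FiniteDimensional K E] [LieGroup 𝓘(K, E) 2 G] [ConnectedSpace G]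
    (φ : D.LieAlgIdent N E G) (g : G) {v : Takiff K L N} (hv : v ∈ D.V N) :
    coadjoint φ g v ∈ D.V N := by
  let P : Submodule K (Takiff K L N) :=
    { carrier := {z | ∀ v ∈ D.V N, form K L N W z v = 0}
      add_mem' := fun {a b} ha hb v hv => by
        rw [map_add, LinearMap.add_apply, ha v hv, hb v hv, add_zero]
      zero_mem' := fun v _ => by simp
      smul_mem' := fun c x hx v hv => by
        rw [map_smul, LinearMap.smul_apply, hx v hv, smul_zero] }
  have hAd := Ad_mem_of_forall_bracket_mem (K := K) (E := E) (G := G)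
    (P.comap φ.toEquiv.toLinearMap) (fun X Y hY v hv => by
      change form K L N W (φ.toEquiv ⁅X, Y⁆) v = 0
      rw [φ.map_bracket, form_bracketR]
      exact hY _ (D.coadR_mem_V N _ hv)) g⁻¹
  apply mem_V_of_forall_form_eq_zero
  intro z hz
  rw [form_coadjoint, form_comm]
  refine hAd (φ.toEquiv.symm z) ?_ v hv
  intro v hv
  change form K L N W (φ.toEquiv (φ.toEquiv.symm z)) v = 0
  rw [LinearEquiv.apply_symm_apply]
  exact hz v hv

theorem orbit_subset_V [FiniteDimensional K E] [LieGroup 𝓘(K, E) 2 G] [ConnectedSpace G]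
    (φ : D.LieAlgIdent N E G) : orbit φ ⊆ D.V N := by
  rintro _ ⟨g, rfl⟩
  exact coadjoint_mem_V φ g (D.x'_mem_V N)

/-- The coordinates of `ν⁻¹ (ν x' ∘ A)` in `V`, as a function of the endomorphism `A` of the
Lie algebra. -/
def orbitCoord (φ : D.LieAlgIdent N E G) :
    (E →L[K] E) →ₗ[K] (Fin (N + 1) × (Fin s ⊕ D.base.support) → K) where
  toFun A := (D.basisV N).equivFun (D.projV N ((D.ν N).symm
    ((D.ν N (D.x' N)) ∘ₗ φ.toEquiv.toLinearMap ∘ₗ A.toLinearMap ∘ₗ φ.toEquiv.symm.toLinearMap)))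
  map_add' A B := by
    rw [← map_add, ← map_add, ← map_add]
    congr 3
    refine LinearMap.ext fun z => ?_
    exact map_add (D.ν N (D.x' N) ∘ₗ φ.toEquiv.toLinearMap) (A (φ.toEquiv.symm z))
      (B (φ.toEquiv.symm z))
  map_smul' c A := by
    rw [RingHom.id_apply, ← map_smul, ← map_smul, ← map_smul]
    congr 3
    refine LinearMap.ext fun z => ?_
    exact map_smul (D.ν N (D.x' N) ∘ₗ φ.toEquiv.toLinearMap) c (A (φ.toEquiv.symm z))

/-- The projection makes `orbitCoord` a linear map on all endomorphisms; it does nothing when the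
represented vector already lies in `V`, as for `A = Ad g` and for the derivative of `Ad` at `1`. -/
theorem orbitCoord_eq (φ : D.LieAlgIdent N E G) (A : E →L[K] E) {v : D.V N}
    (h : ∀ z, form K L N W (D.x' N) (φ.toEquiv (A (φ.toEquiv.symm z))) = form K L N W v z) :
    orbitCoord φ A = (D.basisV N).equivFun v := by
  have h1 : (D.ν N).symm ((D.ν N (D.x' N)) ∘ₗ φ.toEquiv.toLinearMap ∘ₗ A.toLinearMap ∘ₗ
      φ.toEquiv.symm.toLinearMap) = v := by
    rw [LinearEquiv.symm_apply_eq]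
    refine LinearMap.ext fun z => ?_
    exact h z
  change (D.basisV N).equivFun (D.projV N _) = _
  rw [h1, projV_of_mem]

/-- The derivative of the orbit map at the identity is `y ↦ coadR y x'`, which is onto `V`; a
strictly differentiable map with surjective derivative is open at the point. -/
theorem orbitCoord_image_mem_nhds [FiniteDimensional K E] [LieGroup 𝓘(K, E) 2 G] [ConnectedSpace G]
    (φ : D.LieAlgIdent N E G) :
    (D.basisV N).equivFun '' {v : D.V N | (v : Takiff K L N) ∈ orbit φ} ∈
      𝓝 ((D.basisV N).equivFun ⟨D.x' N, D.x'_mem_V N⟩) := by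
  have : LieGroup 𝓘(K, E) 1 G := LieGroup.of_le (n := 2) (by norm_num)
  have : CompleteSpace E := FiniteDimensional.complete K E
  let Ψ := LinearMap.toContinuousLinearMap (orbitCoord φ)
  have hA := (contDiffAt_chartAd (K := K) (E := E) (G := G)).hasStrictFDerivAt one_ne_zero
  have hΨ := Ψ.hasStrictFDerivAt.comp (chartOne K E G) hA
  have hsurj : LinearMap.range
      (Ψ.comp (fderiv K (chartAd K E G) (chartOne K E G))).toLinearMap = ⊤ := by
    rw [LinearMap.range_eq_top]
    intro w
    obtain ⟨y, hy⟩ := D.exists_coadR_x'_eq N ((D.basisV N).equivFun.symm w).2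
    refine ⟨φ.toEquiv.symm y, ?_⟩
    change orbitCoord φ _ = w
    rw [orbitCoord_eq φ _ (v := (D.basisV N).equivFun.symm w), LinearEquiv.apply_symm_apply]
    intro z
    have hb := fderiv_chartAd_eq_bracket (K := K) (E := E) (G := G) (φ.toEquiv.symm y)
      (φ.toEquiv.symm z)
    have hb' := φ.map_bracket (φ.toEquiv.symm y) (φ.toEquiv.symm z)
    rw [LinearEquiv.apply_symm_apply, LinearEquiv.apply_symm_apply] at hb'
    refine (congrArg (fun u => form K L N W (D.x' N) (φ.toEquiv u)) hb.symm).trans ?_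
    rw [hb', form_comm, form_bracketR, hy, form_comm]
  have hmap := hΨ.map_nhds_eq_of_surj hsurj
  have h0 : Ψ (chartAd K E G (chartOne K E G)) =
      (D.basisV N).equivFun ⟨D.x' N, D.x'_mem_V N⟩ := by
    rw [chartAd_chartOne]
    apply orbitCoord_eq φ
    intro z
    change form K L N W (D.x' N) (φ.toEquiv (φ.toEquiv.symm z)) = _
    rw [LinearEquiv.apply_symm_apply]
  rw [← h0, ← hmap, Filter.mem_map]
  filter_upwards [eventually_Ad_eq_chartAd (K := K) (E := E) (G := G)] with y hy
  -- The coadjoint action of `g` involves `Ad g⁻¹`, so the point of the orbit with coordinates given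
  -- by `Ad g` is the one attached to `g⁻¹`.
  refine ⟨⟨coadjoint φ ((extChartAt 𝓘(K, E) (1 : G)).symm y)⁻¹ (D.x' N),
    coadjoint_mem_V φ _ (D.x'_mem_V N)⟩, ⟨_, rfl⟩, ?_⟩
  refine (orbitCoord_eq φ _ fun z => ?_).symm
  rw [form_coadjoint, inv_inv, hy]
  rfl

/-- Homogeneity: the action of `g⁻¹` is linear and continuous on `V`, preserves the orbit and sends
`v` to `x'`, so the neighbourhood of `x'` pulls back to one of `v`. -/
theorem isOpen_orbitCoord [FiniteDimensional K E] [LieGroup 𝓘(K, E) 2 G] [ConnectedSpace G]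
    (φ : D.LieAlgIdent N E G) :
    IsOpen ((D.basisV N).equivFun '' {v : D.V N | (v : Takiff K L N) ∈ orbit φ}) := by
  have : LieGroup 𝓘(K, E) 1 G := LieGroup.of_le (n := 2) (by norm_num)
  rw [isOpen_iff_mem_nhds]
  rintro _ ⟨v, ⟨g, hg⟩, rfl⟩
  let e := (D.basisV N).equivFun
  let T : (Fin (N + 1) × (Fin s ⊕ D.base.support) → K) →ₗ[K]
      (Fin (N + 1) × (Fin s ⊕ D.base.support) → K) :=
    e.toLinearMap ∘ₗ ((coadjoint φ g⁻¹).restrict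
      (fun v hv => coadjoint_mem_V φ g⁻¹ hv)) ∘ₗ e.symm.toLinearMap
  have hT : ∀ u : D.V N, T (e u) = e ⟨coadjoint φ g⁻¹ u, coadjoint_mem_V φ g⁻¹ u.2⟩ := by
    intro u
    simp only [T, LinearMap.comp_apply, LinearEquiv.coe_coe, LinearEquiv.symm_apply_apply]
    rfl
  have hTv : T (e v) = e ⟨D.x' N, D.x'_mem_V N⟩ := by
    rw [hT]
    congr 1
    apply Subtype.ext
    change coadjoint φ g⁻¹ (v : Takiff K L N) = D.x' N
    rw [← hg]
    change coadjoint φ g⁻¹ (coadjoint φ g (D.x' N)) = D.x' N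
    rw [← coadjoint_mul, inv_mul_cancel, coadjoint_one]
  have hc : ContinuousAt T (e v) := T.continuous_of_finiteDimensional.continuousAt
  have h := orbitCoord_image_mem_nhds φ
  rw [← hTv] at h
  filter_upwards [hc h] with w hw
  obtain ⟨u, ⟨k, hk⟩, hu⟩ := hw
  refine ⟨e.symm w, ⟨g * k, ?_⟩, e.apply_symm_apply w⟩
  have h1 := hT (e.symm w)
  rw [e.apply_symm_apply, ← hu] at h1
  have h2 : (u : Takiff K L N) = coadjoint φ g⁻¹ (e.symm w : D.V N) :=
    congrArg Subtype.val (e.injective h1)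
  change coadjoint φ (g * k) (D.x' N) = _
  change coadjoint φ k (D.x' N) = _ at hk
  rw [coadjoint_mul, hk, h2, ← coadjoint_mul, mul_inv_cancel, coadjoint_one]

theorem isOpen_orbit [FiniteDimensional K E] [LieGroup 𝓘(K, E) 2 G] [ConnectedSpace G]
    (φ : D.LieAlgIdent N E G) : IsOpen[moduleTopology K (D.V N)]
      {v : D.V N | (v : Takiff K L N) ∈ orbit φ} := by
  let _ : TopologicalSpace (D.V N) := moduleTopology K (D.V N)
  have : IsModuleTopology K (D.V N) := ⟨rfl⟩
  have hc : Continuous (D.basisV N).equivFun :=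
    IsModuleTopology.continuous_of_linearMap (D.basisV N).equivFun.toLinearMap
  have h := (isOpen_orbitCoord φ).preimage hc
  rwa [Set.preimage_image_eq _ (D.basisV N).equivFun.injective] at h

end Orbit

end TodaData

/-! ### The Lie-Poisson bracket on a symmetric algebra -/

section SymBracket

variable {K : Type*} [Field K] {M M' : Type*} [AddCommGroup M] [Module K M] [AddCommGroup M']
  [Module K M']

theorem symBracket_algebraMap_left (br : M →ₗ[K] M →ₗ[K] M) (c : K) (G : SymmetricAlgebra K M) :
    symBracket br (algebraMap K _ c) G = 0 := by
  simp [symBracket]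

theorem symBracket_ι_algebraMap (br : M →ₗ[K] M →ₗ[K] M) (x : M) (c : K) :
    symBracket br (SymmetricAlgebra.ι K M x) (algebraMap K _ c) = 0 := by
  simp [symBracket, symDerivationₗ]

/-- By construction the bracket is a derivation on the right only when the left entry is a
generator; the derivation property on the left extends this to all `F`. -/
theorem symBracket_mul_right (br : M →ₗ[K] M →ₗ[K] M) (F G G' : SymmetricAlgebra K M) :
    symBracket br F (G * G') = G * symBracket br F G' + G' * symBracket br F G := by
  induction F using SymmetricAlgebra.induction with
  | algebraMap r => simp [symBracket_algebraMap_left]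
  | ι x => exact symBracket_ι_mul br x G G'
  | mul a b ha hb => rw [symBracket_mul_left, symBracket_mul_left, symBracket_mul_left, ha, hb]; ring
  | add a b ha hb => simp only [map_add, LinearMap.add_apply, ha, hb]; ring

theorem symBracket_algebraMap_right (br : M →ₗ[K] M →ₗ[K] M) (c : K) (F : SymmetricAlgebra K M) :
    symBracket br F (algebraMap K _ c) = 0 := by
  induction F using SymmetricAlgebra.induction with
  | algebraMap r => rw [symBracket_algebraMap_left]
  | ι x => exact symBracket_ι_algebraMap br x c
  | mul a b ha hb => rw [symBracket_mul_left, ha, hb]; simp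
  | add a b ha hb => simp only [map_add, LinearMap.add_apply, ha, hb, add_zero]

theorem symBracket_swap {br : M →ₗ[K] M →ₗ[K] M} (hbr : ∀ x y, br x y = -br y x)
    (F G : SymmetricAlgebra K M) : symBracket br F G = -symBracket br G F := by
  induction F using SymmetricAlgebra.induction with
  | algebraMap r => rw [symBracket_algebraMap_left, symBracket_algebraMap_right, neg_zero]
  | ι x =>
    induction G using SymmetricAlgebra.induction with
    | algebraMap r => rw [symBracket_algebraMap_left, symBracket_algebraMap_right, neg_zero]
    | ι y => rw [symBracket_ι_ι, symBracket_ι_ι, hbr, map_neg]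
    | mul a b ha hb => rw [symBracket_mul_left, symBracket_mul_right, ha, hb]; ring
    | add a b ha hb => simp only [map_add, LinearMap.add_apply, ha, hb]; ring
  | mul a b ha hb => rw [symBracket_mul_left, symBracket_mul_right, ha, hb]; ring
  | add a b ha hb => simp only [map_add, LinearMap.add_apply, ha, hb]; ring

/-- The left-hand side of the Jacobi identity for `symBracket`. -/
def symJacobi (br : M →ₗ[K] M →ₗ[K] M) (a b c : SymmetricAlgebra K M) : SymmetricAlgebra K M :=
  symBracket br a (symBracket br b c) + symBracket br b (symBracket br c a) +
    symBracket br c (symBracket br a b)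

theorem symJacobi_cyclic (br : M →ₗ[K] M →ₗ[K] M) (a b c : SymmetricAlgebra K M) :
    symJacobi br a b c = symJacobi br b c a := by
  simp only [symJacobi]
  ring

/-- The Jacobi expression is a derivation in its first argument: the cross terms, such as
`{b,a}{c,a'}` and `{c,a'}{a,b}`, cancel by skewness. Cyclic symmetry then reduces the Jacobi
identity to generators in all three places. -/
theorem symJacobi_eq_zero_of_ι {br : M →ₗ[K] M →ₗ[K] M} (hbr : ∀ x y, br x y = -br y x)
    {b c : SymmetricAlgebra K M} (h : ∀ x, symJacobi br (SymmetricAlgebra.ι K M x) b c = 0)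
    (a : SymmetricAlgebra K M) : symJacobi br a b c = 0 := by
  induction a using SymmetricAlgebra.induction with
  | algebraMap r => simp [symJacobi, symBracket_algebraMap_left, symBracket_algebraMap_right]
  | ι x => exact h x
  | mul a a' ha ha' =>
    have : symJacobi br (a * a') b c = a * symJacobi br a' b c + a' * symJacobi br a b c := by
      simp only [symJacobi, symBracket_mul_left, symBracket_mul_right, map_add]
      rw [symBracket_swap hbr b a, symBracket_swap hbr b a', symBracket_swap hbr c a,
        symBracket_swap hbr c a']
      ring
    rw [this, ha, ha']
    ring
  | add a a' ha ha' =>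
    have : symJacobi br (a + a') b c = symJacobi br a b c + symJacobi br a' b c := by
      simp only [symJacobi, map_add, LinearMap.add_apply]
      ring
    rw [this, ha, ha', add_zero]

/-- The symmetric algebra of a Lie algebra is a Poisson algebra. -/
theorem isPoissonBracket_symBracket [CharZero K] {br : M →ₗ[K] M →ₗ[K] M}
    (hbr : ∀ x y, br x y = -br y x)
    (hjac : ∀ x y z, br x (br y z) + br y (br z x) + br z (br x y) = 0) :
    IsPoissonBracket (symBracket br) where
  self_eq_zero a := by
    have h := symBracket_swap hbr a a
    rw [eq_neg_iff_add_eq_zero, ← two_smul K] at h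
    exact (smul_eq_zero.1 h).resolve_left two_ne_zero
  leibniz a b c := by rw [symBracket_mul_right]; ring
  jacobi a b c := by
    change symJacobi br a b c = 0
    refine symJacobi_eq_zero_of_ι hbr (fun x => ?_) a
    rw [symJacobi_cyclic]
    refine symJacobi_eq_zero_of_ι hbr (fun y => ?_) b
    rw [symJacobi_cyclic]
    refine symJacobi_eq_zero_of_ι hbr (fun z => ?_) c
    simp only [symJacobi, symBracket_ι_ι, ← map_add, hjac, map_zero]

theorem lift_symBracket {br : M →ₗ[K] M →ₗ[K] M} {br' : M' →ₗ[K] M' →ₗ[K] M'} (f : M →ₗ[K] M')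
    (hf : ∀ x y, f (br x y) = br' (f x) (f y)) (F G : SymmetricAlgebra K M) :
    SymmetricAlgebra.lift (SymmetricAlgebra.ι K M' ∘ₗ f) (symBracket br F G) =
      symBracket br' (SymmetricAlgebra.lift (SymmetricAlgebra.ι K M' ∘ₗ f) F)
        (SymmetricAlgebra.lift (SymmetricAlgebra.ι K M' ∘ₗ f) G) := by
  induction F using SymmetricAlgebra.induction with
  | algebraMap r => simp [symBracket_algebraMap_left]
  | ι x =>
    induction G using SymmetricAlgebra.induction with
    | algebraMap r => simp [symBracket_algebraMap_right]
    | ι y => simp [symBracket_ι_ι, hf]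
    | mul a b ha hb => simp only [symBracket_mul_right, map_add, map_mul, ha, hb]
    | add a b ha hb => simp only [map_add, ha, hb]
  | mul a b ha hb => simp only [symBracket_mul_left, map_add, map_mul, ha, hb]
  | add a b ha hb => simp only [map_add, LinearMap.add_apply, ha, hb]

theorem IsPoissonBracket.of_equiv {A B : Type*} [CommRing A] [Algebra K A] [CommRing B]
    [Algebra K B] {P : A →ₗ[K] A →ₗ[K] A} (hP : IsPoissonBracket P) (e : A ≃ₐ[K] B) :
    IsPoissonBracket ((P.compr₂ e.toLinearMap).compl₁₂ e.symm.toLinearMap e.symm.toLinearMap) where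
  self_eq_zero a := by simp [hP.self_eq_zero]
  leibniz a b c := by simp [hP.leibniz]
  jacobi a b c := by
    have := congrArg e (hP.jacobi (e.symm a) (e.symm b) (e.symm c))
    simpa using this

end SymBracket

namespace TodaData

/-! ### The bracket on `V` and polynomial functions on the orbit -/

section PolyFun

set_option linter.unusedSectionVars false

variable {K : Type*} [RCLike K] {L : Type*} [LieRing L] [LieAlgebra K L]
  [FiniteDimensional K L] [LieAlgebra.IsSimple K L] {H : LieSubalgebra K L}
  [H.IsCartanSubalgebra] [LieModule.IsTriangularizable K H L]
  {W : Type*} [AddCommGroup W] [Module K W] [LieRingModule L W] [LieModule K L W] {s : ℕ}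
  (D : TodaData K L H W s) (N : ℕ)

theorem bracketR_swap (x y : Takiff K L N) : D.bracketR N x y = -D.bracketR N y x := by
  rw [bracketR_apply, bracketR_apply, ← lie_skew x, ← lie_skew (D.R N x)]
  abel

theorem bracketV_apply (v w : D.V N) :
    D.bracketV N v w = D.projV N (D.bracketR N v w) := rfl

/-- Pairing `[x, y]_R` with `v ∈ V` gives `(y | coadR x v)_N` with `coadR x v ∈ V`, so only the
projection of `y` matters. In other words, the kernel `V^⊥` of the projection is an ideal. -/
theorem projV_bracketR_right (x y : Takiff K L N) :
    D.projV N (D.bracketR N x y) = D.projV N (D.bracketR N x (D.projV N y)) := by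
  refine projV_eq_of_form_eq fun v hv => ?_
  rw [D.form_projV N _ ⟨v, hv⟩, form_bracketR, form_bracketR]
  exact (D.form_projV N y ⟨_, D.coadR_mem_V N x hv⟩).symm

theorem projV_bracketR (x y : Takiff K L N) :
    D.projV N (D.bracketR N x y) = D.bracketV N (D.projV N x) (D.projV N y) := by
  rw [bracketV_apply, projV_bracketR_right, bracketR_swap, map_neg, projV_bracketR_right,
    ← map_neg, ← bracketR_swap]

theorem bracketV_swap (v w : D.V N) : D.bracketV N v w = -D.bracketV N w v := by
  rw [bracketV_apply, bracketV_apply, bracketR_swap, map_neg]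

theorem bracketV_jacobi (hjac : ∀ x y z : Takiff K L N, D.bracketR N x (D.bracketR N y z) +
      D.bracketR N y (D.bracketR N z x) + D.bracketR N z (D.bracketR N x y) = 0) (u v w : D.V N) :
    D.bracketV N u (D.bracketV N v w) + D.bracketV N v (D.bracketV N w u) +
      D.bracketV N w (D.bracketV N u v) = 0 := by
  have h (a b c : D.V N) : D.bracketV N a (D.bracketV N b c) =
      D.projV N (D.bracketR N a (D.bracketR N b c)) := by
    rw [projV_bracketR, projV_bracketR, projV_of_mem, projV_of_mem, projV_of_mem]
  rw [h, h, h, ← map_add, ← map_add, hjac, map_zero]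

variable {N} {O : Set (Takiff K L N)}

theorem restrict_eq_restrictV (hO : O ⊆ D.V N) (F : SymmetricAlgebra K (Takiff K L N)) :
    D.restrict N O F = D.restrictV N O
      (SymmetricAlgebra.lift (SymmetricAlgebra.ι K (D.V N) ∘ₗ D.projV N) F) := by
  have h : D.restrict N O = (D.restrictV N O).comp
      (SymmetricAlgebra.lift (SymmetricAlgebra.ι K (D.V N) ∘ₗ D.projV N)) := by
    apply SymmetricAlgebra.algHom_ext
    refine LinearMap.ext fun z => Subtype.ext (funext fun x => ?_)
    have ha : D.restrict N O (SymmetricAlgebra.ι K _ z) = D.linFun N O z := by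
      simp [restrict]
    have hb : SymmetricAlgebra.lift (SymmetricAlgebra.ι K (D.V N) ∘ₗ D.projV N)
        (SymmetricAlgebra.ι K _ z) = SymmetricAlgebra.ι K (D.V N) (D.projV N z) := by
      simp
    have hc : D.restrictV N O (SymmetricAlgebra.ι K (D.V N) (D.projV N z)) =
        D.linFun N O (D.projV N z) := by
      simp [restrictV]
    change ((D.restrict N O (SymmetricAlgebra.ι K _ z) : polyFun K O) : O → K) x =
      ((D.restrictV N O (SymmetricAlgebra.lift (SymmetricAlgebra.ι K (D.V N) ∘ₗ D.projV N)
        (SymmetricAlgebra.ι K _ z)) : polyFun K O) : O → K) x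
    rw [ha, hb, hc]
    exact (D.form_projV N z ⟨x, hO x.2⟩).symm
  exact DFunLike.congr_fun h F

/-- Every linear function is `(y | ·)_N` for some `y`, and on `O ⊆ V` it coincides with that of the
projection of `y`. -/
theorem restrictV_surjective (hO : O ⊆ D.V N) : Function.Surjective (D.restrictV N O) := by
  have hle : polyFun K O ≤ ((polyFun K O).val.comp (D.restrictV N O)).range := by
    refine Algebra.adjoin_le ?_
    rintro _ ⟨l, rfl⟩
    obtain ⟨y, rfl⟩ := (D.ν N).surjective l
    refine ⟨SymmetricAlgebra.lift (SymmetricAlgebra.ι K (D.V N) ∘ₗ D.projV N)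
      (SymmetricAlgebra.ι K _ y), ?_⟩
    change ((D.restrictV N O _ : polyFun K O) : O → K) = _
    rw [← D.restrict_eq_restrictV hO]
    simp only [restrict, SymmetricAlgebra.lift_ι_apply]
    rfl
  intro p
  obtain ⟨F, hF⟩ := hle p.2
  exact ⟨F, Subtype.ext hF⟩

/-- The coordinates `v ↦ (b_i | v)_N` on `V`. -/
def coordV : D.V N ≃ₗ[K] (Fin (N + 1) × (Fin s ⊕ D.base.support) → K) :=
  LinearEquiv.ofInjectiveOfFinrankEq
    (LinearMap.pi fun p => form K L N W (D.basisV N p) ∘ₗ (D.V N).subtype) (by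
      rw [← LinearMap.ker_eq_bot, LinearMap.ker_eq_bot']
      intro v hv
      have h : ∀ u : D.V N, form K L N W u v = 0 := by
        intro u
        have h1 : (⊤ : Submodule K (D.V N)) ≤
            LinearMap.ker ((form K L N W).flip v ∘ₗ (D.V N).subtype) := by
          rw [← (D.basisV N).span_eq, Submodule.span_le]
          rintro _ ⟨p, rfl⟩
          exact congrFun hv p
        exact h1 (x := u) trivial
      apply Subtype.ext
      refine eq_of_form_eq D fun z => ?_
      rw [form_comm, ← D.form_projV, h]
      simp) (by
    rw [Module.finrank_eq_card_basis (D.basisV N), Module.finrank_fintype_fun_eq_card])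

/-- An element of `S(V)` is a polynomial in the basis of `V`, and a basis vector `b` acts as the
function `(b | ·)_N`; the point therefore enters through `coordV` and not through its coefficients
in the basis. -/
theorem restrictV_apply (F : SymmetricAlgebra K (D.V N)) (x : O) (hx : (x : Takiff K L N) ∈ D.V N) :
    (D.restrictV N O F : O → K) x = MvPolynomial.eval (D.coordV ⟨x, hx⟩)
      (SymmetricAlgebra.equivMvPolynomial (D.basisV N) F) := by
  have h : (Pi.evalAlgHom K (fun _ : O => K) x).comp ((polyFun K O).val.comp (D.restrictV N O)) =
      (MvPolynomial.aeval (D.coordV ⟨x, hx⟩)).comp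
        (SymmetricAlgebra.equivMvPolynomial (D.basisV N)).toAlgHom := by
    apply SymmetricAlgebra.algHom_ext
    apply (D.basisV N).ext
    intro p
    have h1 : (SymmetricAlgebra.equivMvPolynomial (D.basisV N))
      (SymmetricAlgebra.ι K (D.V N) (D.basisV N p)) = MvPolynomial.X p :=
      SymmetricAlgebra.equivMvPolynomial_ι_apply _ _
    have h2 : D.restrictV N O (SymmetricAlgebra.ι K (D.V N) (D.basisV N p)) =
        D.linFun N O (D.basisV N p) := by
      simp [restrictV, SymmetricAlgebra.lift_ι_apply]
    change ((D.restrictV N O (SymmetricAlgebra.ι K (D.V N) (D.basisV N p)) : polyFun K O) :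
      O → K) x = MvPolynomial.aeval (D.coordV ⟨x, hx⟩)
        (SymmetricAlgebra.equivMvPolynomial (D.basisV N)
          (SymmetricAlgebra.ι K (D.V N) (D.basisV N p)))
    rw [h1, h2, MvPolynomial.aeval_X]
    rfl
  have := DFunLike.congr_fun h F
  rw [← MvPolynomial.aeval_eq_eval]
  exact this

theorem restrictV_injective (hO : IsOpen[moduleTopology K (D.V N)]
      {v : D.V N | (v : Takiff K L N) ∈ O}) (hne : ∃ v : D.V N, (v : Takiff K L N) ∈ O) :
    Function.Injective (D.restrictV N O) := by
  let _ : TopologicalSpace (D.V N) := moduleTopology K (D.V N)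
  have : IsModuleTopology K (D.V N) := ⟨rfl⟩
  have : ContinuousAdd (D.V N) := IsModuleTopology.toContinuousAdd K _
  have hc : Continuous (D.coordV (N := N)).symm :=
    IsModuleTopology.continuous_of_linearMap (D.coordV (N := N)).symm.toLinearMap
  have hopen := hO.preimage hc
  obtain ⟨v, hv⟩ := hne
  obtain ⟨I, u, hu, hsub⟩ := isOpen_pi_iff.1 hopen (D.coordV v) (by simpa using hv)
  rw [injective_iff_map_eq_zero]
  intro F hF
  apply (SymmetricAlgebra.equivMvPolynomial (D.basisV N)).injective
  rw [map_zero]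
  classical
  -- An open set in the product contains a box that restricts only the finitely many coordinates in
  -- `I`. Its sides are infinite, so a polynomial vanishing on it is zero.
  refine MvPolynomial.funext_set (fun p => if p ∈ I then u p else Set.univ) (fun p => ?_)
    fun x hx => ?_
  · split_ifs with hp
    · exact infinite_of_mem_nhds (D.coordV v p) ((hu p hp).1.mem_nhds (hu p hp).2)
    · exact Set.infinite_univ
  · have hx' : x ∈ (I : Set _).pi u := fun p hp => by
      have := hx p trivial
      simp only at this
      rwa [if_pos (by exact hp)] at this
    have hxO : ((D.coordV.symm x : D.V N) : Takiff K L N) ∈ O := hsub hx'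
    have h1 := D.restrictV_apply F ⟨_, hxO⟩ (D.coordV.symm x).2
    rw [hF] at h1
    simpa using h1.symm

end PolyFun

end TodaData

/-! ### The Jacobi identity and the conclusion -/

namespace TodaData

variable {K : Type*} [RCLike K] {L : Type*} [LieRing L] [LieAlgebra K L]
  [FiniteDimensional K L] [LieAlgebra.IsSimple K L] {H : LieSubalgebra K L}
  [H.IsCartanSubalgebra] [LieModule.IsTriangularizable K H L]
  {W : Type*} [AddCommGroup W] [Module K W] [LieRingModule L W] [LieModule K L W] {s : ℕ}
  {D : TodaData K L H W s} {N : ℕ} {E : Type*} [NormedAddCommGroup E] [NormedSpace K E]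
  {G : Type*} [TopologicalSpace G] [ChartedSpace E G] [Group G]

/-- The identity is inherited from the Lie algebra of `G` through `φ`, so no Yang-Baxter equation
has to be verified for `R`. -/
theorem bracketR_jacobi [CompleteSpace E] [LieGroup 𝓘(K, E) (minSmoothness K 3) G]
    (φ : D.LieAlgIdent N E G) (x y z : Takiff K L N) :
    D.bracketR N x (D.bracketR N y z) + D.bracketR N y (D.bracketR N z x) +
      D.bracketR N z (D.bracketR N x y) = 0 := by
  obtain ⟨X, rfl⟩ := φ.toEquiv.surjective x
  obtain ⟨Y, rfl⟩ := φ.toEquiv.surjective y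
  obtain ⟨Z, rfl⟩ := φ.toEquiv.surjective z
  simp only [← φ.map_bracket, ← map_add]
  rw [lie_jacobi, map_zero]

end TodaData

end

end TakiffToda

theorem mainTheorem4 {K : Type*} [RCLike K]
    {L : Type*} [LieRing L] [LieAlgebra K L] [FiniteDimensional K L] [LieAlgebra.IsSimple K L]
    (H : LieSubalgebra K L) [H.IsCartanSubalgebra] [LieModule.IsTriangularizable K H L]
    {W : Type*} [AddCommGroup W] [Module K W] [FiniteDimensional K W] [LieRingModule L W]
    [LieModule K L W] [LieModule.IsFaithful K L W]
    {s : ℕ} (D : TakiffToda.TodaData K L H W s) (N : ℕ)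
    {E : Type*} [NormedAddCommGroup E] [NormedSpace K E] [FiniteDimensional K E]
    {G : Type*} [TopologicalSpace G] [ChartedSpace E G] [Group G]
    [LieGroup 𝓘(K, E) (minSmoothness K 3) G] [ConnectedSpace G]
    (φ : D.LieAlgIdent N E G) :
    (∀ g : G, ∀ v ∈ D.V N, TakiffToda.TodaData.coadjoint φ g v ∈ D.V N) ∧
    Module.finrank K (D.V N) = 2 * s * (N + 1) ∧
    TakiffToda.TodaData.orbit φ ⊆ D.V N ∧
    IsOpen[moduleTopology K (D.V N)] {v : D.V N | (v : TakiffToda.Takiff K L N) ∈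
      TakiffToda.TodaData.orbit φ} ∧
    (∀ z : TakiffToda.Takiff K L N, ∀ v : D.V N,
      TakiffToda.form K L N W (D.projV N z) v = TakiffToda.form K L N W z v) ∧
    ∃ P : TakiffToda.polyFun K (TakiffToda.TodaData.orbit φ) →ₗ[K]
        TakiffToda.polyFun K (TakiffToda.TodaData.orbit φ) →ₗ[K]
        TakiffToda.polyFun K (TakiffToda.TodaData.orbit φ),
      TakiffToda.IsPoissonBracket P ∧
      (∀ F F' : SymmetricAlgebra K (TakiffToda.Takiff K L N),
        D.restrict N (TakiffToda.TodaData.orbit φ)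
            (TakiffToda.symBracket (D.bracketR N) F F') =
          P (D.restrict N (TakiffToda.TodaData.orbit φ) F)
            (D.restrict N (TakiffToda.TodaData.orbit φ) F')) ∧
      Function.Bijective (D.restrictV N (TakiffToda.TodaData.orbit φ)) ∧
      ∀ F F' : SymmetricAlgebra K (D.V N),
        D.restrictV N (TakiffToda.TodaData.orbit φ)
            (TakiffToda.symBracket (D.bracketV N) F F') =
          P (D.restrictV N (TakiffToda.TodaData.orbit φ) F)
            (D.restrictV N (TakiffToda.TodaData.orbit φ) F') := by

  have hG : LieGroup 𝓘(K, E) 2 G := LieGroup.of_le (n := minSmoothness K 3) (by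
    rw [minSmoothness_of_isRCLikeNormedField]; norm_num)
  have : LieGroup 𝓘(K, E) 1 G := LieGroup.of_le (n := 2) (by norm_num)
  have : CompleteSpace E := FiniteDimensional.complete K E
  have hsub := TakiffToda.TodaData.orbit_subset_V φ
  have hopen := TakiffToda.TodaData.isOpen_orbit φ
  have hbij : Function.Bijective (D.restrictV N (TakiffToda.TodaData.orbit φ)) :=
    ⟨D.restrictV_injective hopen ⟨⟨D.x' N, D.x'_mem_V N⟩, 1, by
      simp only [TakiffToda.TodaData.coadjoint_one]⟩, D.restrictV_surjective hsub⟩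
  let e := AlgEquiv.ofBijective _ hbij
  have he : ∀ F, e.symm (D.restrictV N (TakiffToda.TodaData.orbit φ) F) = F :=
    fun F => e.symm_apply_apply F
  -- The bracket on functions is that of `S(V)` transported along `e`. Compatibility with `S(𝔤_N)`
  -- follows because restriction factors through `S(V)` by the projection, a homomorphism for
  -- `bracketR` and `bracketV`.
  have hP := (TakiffToda.isPoissonBracket_symBracket (D.bracketV_swap N)
    (D.bracketV_jacobi N (TakiffToda.TodaData.bracketR_jacobi φ))).of_equiv e
  refine ⟨fun g v hv => TakiffToda.TodaData.coadjoint_mem_V φ g hv, D.finrank_V N, hsub, hopen,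
    D.form_projV N, _, hP, fun F F' => ?_, hbij, fun F F' => ?_⟩
  · rw [D.restrict_eq_restrictV hsub, D.restrict_eq_restrictV hsub F,
      D.restrict_eq_restrictV hsub F', TakiffToda.lift_symBracket (D.projV N) (D.projV_bracketR N)]
    simp only [LinearMap.compl₁₂_apply, LinearMap.compr₂_apply, AlgEquiv.toLinearMap_apply, he]
    rfl
  · simp only [LinearMap.compl₁₂_apply, LinearMap.compr₂_apply, AlgEquiv.toLinearMap_apply, he]
    rfl
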